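/- Model. There is an internal memory holding at most $M$ variables and an unbounded external memory organized in blocks of at most $B$ variables. One I/O moves the variables of one block from external to internal memory (a read) or at most $B$ variables from internal memory to one block (a write); a variable that has been read is no longer in external memory unless it is written back. Evaluating the $s$-star stencil at a vertex $x$ of the grid $[k_1]\times[k_2]$ requires that the inputs of all grid vertices $y$ with $\|y-x\|_1\le s$ are in internal memory simultaneously; it produces one output variable. Variables in internal memory may be deleted at no cost. Initially all inputs are in external memory (each in one block, according to a data layout) and the internal memory is empty; finally all outputs must be in external memory. All I/Os are counted, compulsory and non-compulsory. Bands. Let $m>2s$. For $j,t\in\mathbb Z$ the diagonal sweep shape number $t$ of working band $j$ consists of the $m$ vertices $(j(2m-2s)+\lceil t/2\rceil,\lfloor t/2\rfloor)+i\,(1,-1)$, $0\le i<m$, so that it is shifted alternately in the two unit directions; working band $j$ is the union of its sweep shapes. Adjacent working bands overlap in wing bands ($2s$ vertices per row); the vertices lying in only one working band form its core band ($2m-4s$ vertices per row). In the block aligned diagonal layout every core band and every wing band of the grid is stored in separate blocks, in each of which (except the last of a band) there are $B$ consecutive vertices of the band, ordered by sweep shapes and along the diagonal within a sweep shape. A diagonal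 sweep evaluates each vertex of the grid exactly once, working band after working band in order of increasing $j$, within a working band in order of increasing $t$; the vertices evaluated in working band $j$ are those whose $\ell^1$ ball of radius $s$ in $\mathbb Z^2$ is contained in that band. Theorem. For every $s\ge 1$ there are constants $C$ and $N$, depending only on $s$, such that for all $M$, $B\ge 1$ and $k_1\ge k_2\ge 5M+1$ with $M\ge N B$ there are an $m>2s$ with $2sm\le M\le 2sm+CB$ and a diagonal sweep algorithm that, using the block aligned diagonal layout, evaluates the $s$-star stencil on $[k_1]\times[k_2]$ with at most $$\left(2+\frac{4s^2}{M}+C\left(\frac{B}{M^2}+\frac1{k_1}\right)\right)\cdot\frac{k_1k_2}{B}$$ I/Os. The constant $4s^2$ of the leading non-compulsory term equals the value at $n=2$ of the constant $4(n-1)\left(\frac{2}{n!}s^n\right)^{1/(n-1)}$ of the leading non-compulsory term $4(n-1)\left(\frac{2}{n!}s^n\right)^{1/(n-1)}M^{-1/(n-1)}\cdot\frac{\prod_i k_i}{B}$ of the lower bound for the $s$-star stencil on $[k_1]\times\dots\times[k_n]$. -/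

import Mathlib

namespace StencilIO

/-! ### The grid and the star stencil -/

/-- Points of the plane lattice; the vertices of the grid are among them. -/
abbrev Vertex := ℤ × ℤ

/-- The grid `[k₁] × [k₂]`, where `[k] = {1, …, k}`. -/
noncomputable def grid (k₁ k₂ : ℕ) : Finset Vertex :=
  Finset.Icc (1 : ℤ) (k₁ : ℤ) ×ˢ Finset.Icc (1 : ℤ) (k₂ : ℤ)

/-- The `ℓ¹` distance. -/
def dist1 (x y : Vertex) : ℤ := |x.1 - y.1| + |x.2 - y.2|

/-- The `s`-star stencil on the grid with center `x`. -/
noncomputable def starStencil (s k₁ k₂ : ℕ) (x : Vertex) : Finset Vertex :=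
  (grid k₁ k₂).filter fun y => dist1 y x ≤ (s : ℤ)

/-! ### The I/O model -/

/-- A variable: the input value `x_in` or the output value `x_out` at a vertex `x`. -/
inductive Item where
  | input (x : Vertex)
  | output (x : Vertex)
  deriving DecidableEq

/-- The contents of the internal memory and of the blocks `0, 1, 2, …` of the (infinite)
external memory. -/
structure Config where
  internal : Finset Item
  external : ℕ → Finset Item

/-- Operations of the machine. An I/O (`read` or `write`) moves the contents of one block:
what is read no longer resides in external memory, so it has to be written back
(by another I/O) if it is to be loaded again later. -/
inductive Instr where
  /-- move all variables of block `a` to internal memory -/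
  | read (a : ℕ)
  /-- move the variables `S` from internal memory to block `a`, which they then make up -/
  | write (a : ℕ) (S : Finset Item)
  /-- compute the output value at `x` in internal memory -/
  | eval (x : Vertex)
  /-- delete the variables `S` from internal memory -/
  | discard (S : Finset Item)

/-- The configuration after an operation. -/
def Instr.next : Instr → Config → Config
  | .read a, c => ⟨c.internal ∪ c.external a, Function.update c.external a ∅⟩
  | .write a S, c => ⟨c.internal \ S, Function.update c.external a S⟩
  | .eval x, c => ⟨insert (.output x) c.internal, c.external⟩
  | .discard S, c => ⟨c.internal \ S, c.external⟩

/-- When an operation is permitted, for an internal memory of `M` variables and blocks of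
`B` variables. Evaluating the stencil at `x` needs all inputs in the stencil of `x` to be in
internal memory at the same time (no partial computations). -/
def Instr.Legal (s M B k₁ k₂ : ℕ) : Instr → Config → Prop
  | .read a, c => (c.internal ∪ c.external a).card ≤ M
  | .write _ S, c => S ⊆ c.internal ∧ S.card ≤ B
  | .eval x, c => x ∈ grid k₁ k₂ ∧ (∀ y ∈ starStencil s k₁ k₂ x, Item.input y ∈ c.internal) ∧
      (insert (Item.output x) c.internal).card ≤ M
  | .discard _, _ => True

/-- An algorithm, for given parameters, is the sequence of operations it performs. -/
abbrev Algorithm := List Instr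

/-- All operations are permitted, when executed one after the other starting at `c`. -/
def LegalFrom (s M B k₁ k₂ : ℕ) : Config → Algorithm → Prop
  | _, [] => True
  | c, i :: P => i.Legal s M B k₁ k₂ c ∧ LegalFrom s M B k₁ k₂ (i.next c) P

/-- The configuration after the algorithm `P`, started at `c`. -/
def runFrom : Config → Algorithm → Config
  | c, [] => c
  | c, i :: P => runFrom (i.next c) P

/-- An operation is an I/O if it transfers a block. -/
def Instr.isIO : Instr → Bool
  | .read _ => true
  | .write _ _ => true
  | .eval _ => false
  | .discard _ => false

/-- The number of I/Os of an algorithm, compulsory or not. -/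
def ioCount (P : Algorithm) : ℕ := P.countP Instr.isIO

/-- The vertices at which the algorithm evaluates the stencil, in chronological order. -/
def evaluated (P : Algorithm) : List Vertex :=
  P.filterMap fun i => match i with
    | .eval x => some x
    | _ => none

/-- A data layout: `L x` is the block in which the input value at `x` is stored initially.
At most `B` values fit into a block. -/
def IsDataLayout (B k₁ k₂ : ℕ) (L : Vertex → ℕ) : Prop :=
  ∀ a : ℕ, ((grid k₁ k₂).filter fun x => L x = a).card ≤ B

/-- Initially the internal memory is empty and all inputs are in external memory. -/
noncomputable def initial (k₁ k₂ : ℕ) (L : Vertex → ℕ) : Config where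
  internal := ∅
  external := fun a => ((grid k₁ k₂).filter fun x => L x = a).image Item.input

/-- Using the data layout `L`, the algorithm `P` evaluates the `s`-star stencil at all vertices
of the grid and writes all results to external memory. -/
def EvaluatesStencil (s M B k₁ k₂ : ℕ) (L : Vertex → ℕ) (P : Algorithm) : Prop :=
  IsDataLayout B k₁ k₂ L ∧
  LegalFrom s M B k₁ k₂ (initial k₁ k₂ L) P ∧
  ∀ x ∈ grid k₁ k₂, ∃ a : ℕ, Item.output x ∈ (runFrom (initial k₁ k₂ L) P).external a

/-! ### The diagonal sweep and the block aligned diagonal layout -/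

/-- The diagonal sweep shape number `t` of working band number `j`: `m` consecutive vertices in
direction `(1, -1)`. The shapes of a band arise from each other by shifts alternately in
direction `(1, 0)` and `(0, 1)`, and consecutive bands are `2m - 2s` apart in direction `(1, 0)`. -/
def sweepShape (s m : ℕ) (j t : ℤ) : Set Vertex :=
  {x | ∃ i : ℕ, i < m ∧
    x = (j * (2 * (m : ℤ) - 2 * (s : ℤ)) + (t + 1) / 2 + (i : ℤ), t / 2 - (i : ℤ))}

/-- Working band number `j`: the vertices met by its sweep shapes. -/
def workingBand (s m : ℕ) (j : ℤ) : Set Vertex :=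
  {x | ∃ t : ℤ, x ∈ sweepShape s m j t}

theorem mem_sweepShape_iff (s m : ℕ) (j t : ℤ) (x : Vertex) :
    x ∈ sweepShape s m j t ↔
      x.1 + x.2 = j * (2 * (m : ℤ) - 2 * (s : ℤ)) + t ∧
      j * (2 * (m : ℤ) - 2 * (s : ℤ)) ≤ x.1 - x.2 ∧
      x.1 - x.2 < j * (2 * (m : ℤ) - 2 * (s : ℤ)) + 2 * (m : ℤ) := by
  obtain ⟨a, b⟩ := x
  simp only [sweepShape, Set.mem_ofPred_eq, Prod.mk.injEq]
  generalize j * (2 * (m : ℤ) - 2 * (s : ℤ)) = q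
  constructor
  · rintro ⟨i, hi, rfl, rfl⟩
    omega
  · rintro ⟨h1, h2, h3⟩
    exact ⟨(t / 2 - b).toNat, by omega, by omega, by omega⟩

theorem mem_workingBand_iff (s m : ℕ) (j : ℤ) (x : Vertex) :
    x ∈ workingBand s m j ↔
      j * (2 * (m : ℤ) - 2 * (s : ℤ)) ≤ x.1 - x.2 ∧
      x.1 - x.2 < j * (2 * (m : ℤ) - 2 * (s : ℤ)) + 2 * (m : ℤ) := by
  simp only [workingBand, Set.mem_ofPred_eq, mem_sweepShape_iff]
  exact ⟨fun ⟨_, h⟩ => h.2,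
    fun h => ⟨x.1 + x.2 - j * (2 * (m : ℤ) - 2 * (s : ℤ)), by ring, h⟩⟩

/-- Two vertices are in the same core or wing band if they lie in the same working bands.
For `2s < m` the vertices that lie in working band `j` only form its core band, and those in the
overlap of the working bands `j` and `j + 1` form a wing band; these have `2m - 4s` respectively
`2s` vertices per row. -/
def SameBand (s m : ℕ) (x y : Vertex) : Prop :=
  ∀ j : ℤ, x ∈ workingBand s m j ↔ y ∈ workingBand s m j

open scoped Classical in
/-- The position (starting at `0`) of the grid vertex `x` among the grid vertices of its core or
wing band, which are ordered by sweep shapes and along the diagonal within a sweep shape. -/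
noncomputable def bandPosition (s m k₁ k₂ : ℕ) (x : Vertex) : ℕ :=
  ((grid k₁ k₂).filter fun y => SameBand s m x y ∧
    (y.1 + y.2 < x.1 + x.2 ∨ (y.1 + y.2 = x.1 + x.2 ∧ y.1 < x.1))).card

/-- The block aligned diagonal layout: every core band and every wing band is stored in blocks of
its own, each (except the last one of a band) holding `B` vertices that are consecutive in the
order of the band. -/
def IsBlockAlignedDiagonal (s m B k₁ k₂ : ℕ) (L : Vertex → ℕ) : Prop :=
  ∀ x ∈ grid k₁ k₂, ∀ y ∈ grid k₁ k₂,
    (L x = L y ↔ SameBand s m x y ∧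
      bandPosition s m k₁ k₂ x / B = bandPosition s m k₁ k₂ y / B)

/-- `x` is evaluated by sweep shape `t` of working band `j`: it belongs to that sweep shape, and
all vertices at distance at most `s` from `x` belong to the working band. -/
def EvaluatedAt (s m : ℕ) (j t : ℤ) (x : Vertex) : Prop :=
  x ∈ sweepShape s m j t ∧ ∀ y : Vertex, dist1 y x ≤ (s : ℤ) → y ∈ workingBand s m j

/-- The algorithm is a diagonal sweep: it evaluates every vertex of the grid exactly once,
working band by working band, and sweep shape by sweep shape within a working band. -/
def IsDiagonalSweep (s m k₁ k₂ : ℕ) (P : Algorithm) : Prop :=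
  (evaluated P).Nodup ∧
  (∀ x, x ∈ evaluated P ↔ x ∈ grid k₁ k₂) ∧
  (evaluated P).Pairwise fun x y => ∃ j t j' t' : ℤ,
    EvaluatedAt s m j t x ∧ EvaluatedAt s m j' t' y ∧ (j < j' ∨ (j = j' ∧ t ≤ t'))

/-- The constant `4 (n - 1) (2 sⁿ / n!) ^ (1 / (n - 1))`: in the lower bound for the `s`-star
stencil in `n` dimensions, the leading term of the non-compulsory I/Os is this constant times
`M ^ (-1 / (n - 1)) · ∏ kᵢ / B`. -/
noncomputable def lowerBoundConstant (n s : ℕ) : ℝ :=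
  4 * ((n : ℝ) - 1) * (2 / (n.factorial : ℝ) * (s : ℝ) ^ n) ^ (1 / ((n : ℝ) - 1))

end StencilIO

/-! A window slides through one working band at a time. The vertices of the band are ordered by
sweep shape and then along the diagonal. A star of radius `s` reaches at most `s*m + s` positions to
either side of its center, since `x.1 + x.2` changes by at most `s` and a shape has `m` vertices.
Hence `2*(s*m + s) + 1` consecutive positions are enough. Keeping whole blocks costs at most `6*B`
more: each end of the window cuts at most one block in each of the three core and wing bands of a
working band (`card_activeBlocks_vertices_le`). A further `B` variables buffer outputs, so `2*s*m`
can be as large as `M - O(B)`.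

A block stays in memory for one interval of time per working band (`activeBlocks_convex`). So core
blocks are read once, and wing blocks are read at most twice and written back at most once. With the
outputs this gives `2*k₁*k₂/B` I/Os, plus twice the number of wing vertices over `B`, plus rounding
(`exists_diagonalSweep`). Wings take up a share of about `2s/(2m-2s)`, so the excess factor is
`2s/(m-s) = 4s²/(2s(m-s)) = 4s²/M + O(B/M²)`. Rounding costs four blocks for each of `O(k₁/M)`
working bands, which is `O(k₁*k₂/M²)` because `M ≤ k₂`; incomplete periods of the wings in the rows
give the term `1/k₁` (`sweep_cost_le`).

The machine is dealt with once and for all by `exists_algorithm_of_schedule`, which turns a sequence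
of sets of blocks and of vertices into a legal algorithm. What remains is counting blocks. -/

namespace StencilIO

/-! ### Composition of algorithms -/

theorem runFrom_append (c : Config) (P Q : Algorithm) :
    runFrom c (P ++ Q) = runFrom (runFrom c P) Q := by
  induction P generalizing c with
  | nil => rfl
  | cons i P ih => exact ih _

theorem legalFrom_append {s M B k₁ k₂ : ℕ} {c : Config} {P Q : Algorithm}
    (hP : LegalFrom s M B k₁ k₂ c P) (hQ : LegalFrom s M B k₁ k₂ (runFrom c P) Q) :
    LegalFrom s M B k₁ k₂ c (P ++ Q) := by
  induction P generalizing c with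
  | nil => exact hQ
  | cons i P ih => exact ⟨hP.1, ih hP.2 hQ⟩

theorem evaluated_append (P Q : Algorithm) : evaluated (P ++ Q) = evaluated P ++ evaluated Q :=
  List.filterMap_append

theorem ioCount_append (P Q : Algorithm) : ioCount (P ++ Q) = ioCount P + ioCount Q :=
  List.countP_append

/-! ### Loading and releasing whole blocks -/

/-- The internal memory that holds the inputs of the blocks in `X` and the outputs at `O`. -/
noncomputable def loaded (k₁ k₂ : ℕ) (L : Vertex → ℕ) (X : Finset ℕ) (O : Finset Vertex) :
    Finset Item :=
  ((grid k₁ k₂).filter fun x => L x ∈ X).image Item.input ∪ O.image Item.output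

section Blocks

variable {s M B k₁ k₂ : ℕ} {L : Vertex → ℕ}

@[simp] theorem input_mem_loaded {X : Finset ℕ} {O : Finset Vertex} {x : Vertex} :
    Item.input x ∈ loaded k₁ k₂ L X O ↔ x ∈ grid k₁ k₂ ∧ L x ∈ X := by
  simp [loaded]

@[simp] theorem output_mem_loaded {X : Finset ℕ} {O : Finset Vertex} {x : Vertex} :
    Item.output x ∈ loaded k₁ k₂ L X O ↔ x ∈ O := by
  simp [loaded]

@[simp] theorem input_mem_initial {a : ℕ} {x : Vertex} :
    Item.input x ∈ (initial k₁ k₂ L).external a ↔ x ∈ grid k₁ k₂ ∧ L x = a := by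
  simp [initial]

@[simp] theorem output_notMem_initial {a : ℕ} {x : Vertex} :
    Item.output x ∉ (initial k₁ k₂ L).external a := by
  simp [initial]

theorem card_loaded_le (X : Finset ℕ) (O : Finset Vertex) :
    (loaded k₁ k₂ L X O).card ≤ ((grid k₁ k₂).filter fun x => L x ∈ X).card + O.card :=
  (Finset.card_union_le _ _).trans (Nat.add_le_add Finset.card_image_le Finset.card_image_le)

theorem card_loaded_mono {X Y : Finset ℕ} {O : Finset Vertex} (h : X ⊆ Y) :
    (loaded k₁ k₂ L X O).card ≤ (loaded k₁ k₂ L Y O).card := by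
  refine Finset.card_le_card fun z hz => ?_
  cases z with
  | input x => simp only [input_mem_loaded] at hz ⊢; exact ⟨hz.1, h hz.2⟩
  | output x => simpa using hz

theorem loaded_insert (X : Finset ℕ) (O : Finset Vertex) (a : ℕ) :
    loaded k₁ k₂ L X O ∪ (initial k₁ k₂ L).external a = loaded k₁ k₂ L (insert a X) O := by
  ext z
  cases z <;> simp
  tauto

theorem loaded_erase (X : Finset ℕ) (O : Finset Vertex) (a : ℕ) :
    loaded k₁ k₂ L X O \ (initial k₁ k₂ L).external a = loaded k₁ k₂ L (X.erase a) O := by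
  ext z
  cases z <;> simp
  tauto

/-- Memory only grows during the reads, so the bound on the final contents makes every single read
legal. -/
theorem exists_read_blocks (s : ℕ) (B : ℕ) (O : Finset Vertex) (R : Finset ℕ) :
    ∀ (X : Finset ℕ) (c : Config), c.internal = loaded k₁ k₂ L X O →
      (∀ a ∈ R, c.external a = (initial k₁ k₂ L).external a) →
      (loaded k₁ k₂ L (X ∪ R) O).card ≤ M →
      ∃ P : Algorithm, LegalFrom s M B k₁ k₂ c P ∧ evaluated P = [] ∧ ioCount P = R.card ∧
        (runFrom c P).internal = loaded k₁ k₂ L (X ∪ R) O ∧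
        ∀ a ∉ R, (runFrom c P).external a = c.external a := by
  induction R using Finset.induction_on with
  | empty => exact fun X c h _ _ => ⟨[], trivial, rfl, rfl, by simpa [runFrom] using h, fun _ _ => rfl⟩
  | insert a R ha ih =>
    intro X c h hR hM
    have hnext : c.internal ∪ c.external a = loaded k₁ k₂ L (insert a X) O := by
      rw [h, hR a (Finset.mem_insert_self a R), loaded_insert]
    have hunion : insert a X ∪ R = X ∪ insert a R := by
      rw [Finset.insert_union, Finset.union_insert]
    obtain ⟨P, h1, h2, h3, h4, h5⟩ := ih (insert a X) (Instr.next (.read a) c) hnext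
      (fun b hb => by
        have : b ≠ a := fun h => ha (h ▸ hb)
        simpa [Instr.next, Function.update_of_ne this] using hR b (Finset.mem_insert_of_mem hb))
      (by rwa [hunion])
    refine ⟨.read a :: P, ⟨?_, h1⟩, h2, ?_, ?_, ?_⟩
    · change (c.internal ∪ c.external a).card ≤ M
      rw [hnext]
      exact (card_loaded_mono (by rw [← hunion]; exact Finset.subset_union_left)).trans hM
    · rw [Finset.card_insert_of_notMem ha, ← h3]
      exact List.countP_cons_of_pos rfl
    · rw [← hunion]; exact h4
    · intro b hb
      rw [Finset.mem_insert, not_or] at hb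
      exact (h5 b hb.2).trans (Function.update_of_ne hb.1 _ _)

/-- Each block regains exactly its initial contents, so a block written back can later be read as if
for the first time. -/
theorem exists_write_blocks (s M : ℕ) (hL : IsDataLayout B k₁ k₂ L) (O : Finset Vertex)
    (R : Finset ℕ) :
    ∀ (X : Finset ℕ) (c : Config), c.internal = loaded k₁ k₂ L X O → R ⊆ X →
      ∃ P : Algorithm, LegalFrom s M B k₁ k₂ c P ∧ evaluated P = [] ∧ ioCount P = R.card ∧
        (runFrom c P).internal = loaded k₁ k₂ L (X \ R) O ∧
        (∀ a ∈ R, (runFrom c P).external a = (initial k₁ k₂ L).external a) ∧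
        ∀ a ∉ R, (runFrom c P).external a = c.external a := by
  induction R using Finset.induction_on with
  | empty =>
    exact fun X c h _ => ⟨[], trivial, rfl, rfl, by simpa [runFrom] using h, by simp, fun _ _ => rfl⟩
  | insert a R ha ih =>
    intro X c h hR
    have hnext : c.internal \ (initial k₁ k₂ L).external a = loaded k₁ k₂ L (X.erase a) O := by
      rw [h, loaded_erase]
    have hX : X.erase a \ R = X \ insert a R := by
      ext b; simp; tauto
    obtain ⟨P, h1, h2, h3, h4, h5, h6⟩ :=
      ih (X.erase a) (Instr.next (.write a ((initial k₁ k₂ L).external a)) c) hnext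
      (fun b hb => Finset.mem_erase.2 ⟨fun h => ha (h ▸ hb), hR (Finset.mem_insert_of_mem hb)⟩)
    refine ⟨.write a ((initial k₁ k₂ L).external a) :: P, ⟨⟨?_, ?_⟩, h1⟩, h2, ?_, ?_, ?_, ?_⟩
    · rw [h]
      intro z hz
      cases z with
      | input x =>
        rw [input_mem_initial] at hz
        exact input_mem_loaded.2 ⟨hz.1, hz.2 ▸ hR (Finset.mem_insert_self a R)⟩
      | output x => exact absurd hz output_notMem_initial
    · exact Finset.card_image_le.trans (hL a)
    · rw [Finset.card_insert_of_notMem ha, ← h3]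
      exact List.countP_cons_of_pos rfl
    · rw [← hX]; exact h4
    · intro b hb
      by_cases hbR : b ∈ R
      · exact h5 b hbR
      · obtain rfl : b = a := (Finset.mem_insert.1 hb).resolve_right hbR
        exact (h6 b hbR).trans (Function.update_self _ _ _)
    · intro b hb
      rw [Finset.mem_insert, not_or] at hb
      exact (h6 b hb.2).trans (Function.update_of_ne hb.1 _ _)

theorem exists_discard_blocks (s M B : ℕ) (O : Finset Vertex) (X R : Finset ℕ) (c : Config)
    (h : c.internal = loaded k₁ k₂ L X O) :
    ∃ P : Algorithm, LegalFrom s M B k₁ k₂ c P ∧ evaluated P = [] ∧ ioCount P = 0 ∧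
      (runFrom c P).internal = loaded k₁ k₂ L (X \ R) O ∧
      (runFrom c P).external = c.external := by
  refine ⟨[.discard (loaded k₁ k₂ L R ∅)], ⟨trivial, trivial⟩, rfl, rfl, ?_, rfl⟩
  change c.internal \ _ = _
  rw [h]
  ext z
  cases z <;> simp
  tauto

/-- Passing from the blocks `X` to the blocks `Y`, writing back only the blocks in `K`. -/
theorem exists_exchange_blocks (s : ℕ) (hL : IsDataLayout B k₁ k₂ L) (O : Finset Vertex)
    (X Y K : Finset ℕ) (c : Config) (h : c.internal = loaded k₁ k₂ L X O) (hK : K ⊆ X \ Y)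
    (hext : ∀ a ∈ Y \ X, c.external a = (initial k₁ k₂ L).external a)
    (hM : (loaded k₁ k₂ L Y O).card ≤ M) :
    ∃ P : Algorithm, LegalFrom s M B k₁ k₂ c P ∧ evaluated P = [] ∧
      ioCount P = (Y \ X).card + K.card ∧
      (runFrom c P).internal = loaded k₁ k₂ L Y O ∧
      (∀ a ∈ K, (runFrom c P).external a = (initial k₁ k₂ L).external a) ∧
      ∀ a ∉ K, a ∉ Y \ X → (runFrom c P).external a = c.external a := by
  -- Writing and discarding precede reading, so memory never has to hold more than the larger of the
  -- start and the end state.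
  obtain ⟨P, p1, p2, p3, p4, p5, p6⟩ :=
    exists_write_blocks s M hL O K X c h (hK.trans Finset.sdiff_subset)
  obtain ⟨Q, q1, q2, q3, q4, q5⟩ :=
    exists_discard_blocks s M B O (X \ K) ((X \ Y) \ K) (runFrom c P) p4
  have hX : (X \ K) \ ((X \ Y) \ K) = X ∩ Y := by
    ext a
    have := @hK a
    simp only [Finset.mem_sdiff, Finset.mem_inter] at this ⊢
    tauto
  have hXY : X ∩ Y ∪ Y \ X = Y := by
    ext a; simp only [Finset.mem_union, Finset.mem_inter, Finset.mem_sdiff]; tauto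
  have hdis : ∀ a ∈ K, a ∉ Y \ X := fun a ha ha' =>
    (Finset.mem_sdiff.1 (hK ha)).2 (Finset.mem_sdiff.1 ha').1
  rw [hX] at q4
  obtain ⟨R, r1, r2, r3, r4, r5⟩ := exists_read_blocks (M := M) s B O (Y \ X) (X ∩ Y)
    (runFrom (runFrom c P) Q) q4
    (fun a ha => by rw [q5, p6 a fun hk => hdis a hk ha, hext a ha]) (by rwa [hXY])
  refine ⟨P ++ (Q ++ R), legalFrom_append p1 (legalFrom_append q1 r1), ?_, ?_, ?_, ?_, ?_⟩
  · simp [evaluated_append, p2, q2, r2]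
  · rw [ioCount_append, ioCount_append, p3, q3, r3]; omega
  · rw [runFrom_append, runFrom_append, r4, hXY]
  · intro a ha
    rw [runFrom_append, runFrom_append, r5 a (hdis a ha), q5, p5 a ha]
  · intro a ha ha'
    rw [runFrom_append, runFrom_append, r5 a ha', q5, p6 a ha]

/-! ### Executing a schedule -/

open scoped Classical in
/-- The blocks released after step `T` of the schedule `A` that are needed again later on. -/
noncomputable def writtenBack (A : ℕ → Finset ℕ) (T : ℕ) : Finset ℕ :=
  (A T \ A (T + 1)).filter fun a => ∃ T', T + 1 < T' ∧ a ∈ A T'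

theorem mem_writtenBack {A : ℕ → Finset ℕ} {T a : ℕ} :
    a ∈ writtenBack A T ↔ a ∈ A T ∧ a ∉ A (T + 1) ∧ ∃ T', T + 1 < T' ∧ a ∈ A T' := by
  simp only [writtenBack, Finset.mem_filter, Finset.mem_sdiff, and_assoc]

theorem writtenBack_subset (A : ℕ → Finset ℕ) (T : ℕ) : writtenBack A T ⊆ A T \ A (T + 1) := by
  classical exact Finset.filter_subset _ _

/-- Output blocks are the odd ones; `q` of them are full. -/
structure ScheduleState (B k₁ k₂ : ℕ) (L : Vertex → ℕ) (A : ℕ → Finset ℕ) (e : ℕ → Option Vertex)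
    (T q : ℕ) (O : Finset Vertex) (c : Config) : Prop where
  internal : c.internal = loaded k₁ k₂ L (A T) O
  -- Only blocks with a future use must be intact; the others may have been discarded.
  external : ∀ a, Even a → a ∉ A T → (∃ T', T < T' ∧ a ∈ A T') →
    c.external a = (initial k₁ k₂ L).external a
  saved : ∀ t x, t < T → e t = some x →
    x ∈ O ∨ ∃ p, p < q ∧ Item.output x ∈ c.external (2 * p + 1)
  buffered : ∀ x ∈ O, ∃ t, t < T ∧ e t = some x
  card_lt : O.card < B
  count : q * B + O.card = ((List.range T).filterMap e).length

/-- The buffer is flushed to block `2 * q + 1` as soon as it holds `B` outputs. It is thus never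
full before an evaluation, and the `B` places reserved by `hM` suffice. -/
theorem exists_evaluate_output {X : Finset ℕ} {O : Finset Vertex} {q : ℕ} {x : Vertex}
    {c : Config} (hc : c.internal = loaded k₁ k₂ L X O) (hx : x ∈ grid k₁ k₂)
    (hst : ∀ y ∈ starStencil s k₁ k₂ x, L y ∈ X) (hxO : x ∉ O) (hO : O.card < B)
    (hM : ((grid k₁ k₂).filter fun x => L x ∈ X).card + B ≤ M) :
    ∃ (P : Algorithm) (O' : Finset Vertex) (q' : ℕ), LegalFrom s M B k₁ k₂ c P ∧
      evaluated P = [x] ∧ ioCount P + q = q' ∧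
      (runFrom c P).internal = loaded k₁ k₂ L X O' ∧ O' ⊆ insert x O ∧ O'.card < B ∧
      q' * B + O'.card = q * B + O.card + 1 ∧
      (∀ y ∈ insert x O, y ∈ O' ∨
        ∃ p, p < q' ∧ Item.output y ∈ (runFrom c P).external (2 * p + 1)) ∧
      ∀ a, a ≠ 2 * q + 1 → (runFrom c P).external a = c.external a := by
  have hins : insert (Item.output x) c.internal = loaded k₁ k₂ L X (insert x O) := by
    rw [hc]; ext z; cases z <;> simp
  have hcard : (insert x O).card = O.card + 1 := Finset.card_insert_of_notMem hxO
  have heval : Instr.Legal s M B k₁ k₂ (.eval x) c := by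
    refine ⟨hx, fun y hy => ?_, ?_⟩
    · rw [hc, input_mem_loaded]
      exact ⟨(Finset.mem_filter.1 hy).1, hst y hy⟩
    · rw [hins]
      have := card_loaded_le (k₁ := k₁) (k₂ := k₂) (L := L) X (insert x O)
      omega
  by_cases hfull : O.card + 1 < B
  · exact ⟨[.eval x], insert x O, q, ⟨heval, trivial⟩, rfl, by simp [ioCount, Instr.isIO], hins,
      Finset.Subset.refl _, by omega, by omega, fun y hy => Or.inl hy, fun _ _ => rfl⟩
  · refine ⟨[.eval x, .write (2 * q + 1) ((insert x O).image Item.output)], ∅, q + 1,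
      ⟨heval, ⟨?_, ?_⟩, trivial⟩, rfl, ?_, ?_, by simp, by simp; omega, ?_, ?_, ?_⟩
    · change _ ⊆ insert (Item.output x) c.internal
      rw [hins]
      exact Finset.subset_union_right
    · exact Finset.card_image_le.trans (by omega)
    · simp [ioCount, Instr.isIO, add_comm]
    · change insert (Item.output x) c.internal \ _ = _
      rw [hins]
      ext z
      cases z <;> simp
      tauto
    · rw [Finset.card_empty, add_mul]; omega
    · intro y hy
      refine Or.inr ⟨q, by omega, ?_⟩
      change Item.output y ∈ Function.update c.external (2 * q + 1) _ (2 * q + 1)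
      rw [Function.update_self]
      exact Finset.mem_image_of_mem _ hy
    · intro a ha
      exact Function.update_of_ne ha _ _

/-- The step evaluates with the blocks `A T` and then exchanges them for `A (T + 1)`. Inputs use
even blocks and outputs odd ones, so neither overwrites the other. -/
theorem exists_step {A : ℕ → Finset ℕ} {e : ℕ → Option Vertex} (hL : IsDataLayout B k₁ k₂ L) (hA : ∀ T, ∀ a ∈ A T, Even a)
    (hM : ∀ T, ((grid k₁ k₂).filter fun x => L x ∈ A T).card + B ≤ M)
    (he : ∀ T x, e T = some x → x ∈ grid k₁ k₂ ∧ ∀ y ∈ starStencil s k₁ k₂ x, L y ∈ A T)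
    (hinj : ∀ T T' x, e T = some x → e T' = some x → T = T')
    {T q : ℕ} {O : Finset Vertex} {c : Config} (h : ScheduleState B k₁ k₂ L A e T q O c) :
    ∃ (P : Algorithm) (q' : ℕ) (O' : Finset Vertex), LegalFrom s M B k₁ k₂ c P ∧
      evaluated P = (e T).toList ∧
      ioCount P + q = (A (T + 1) \ A T).card + (writtenBack A T).card + q' ∧
      ScheduleState B k₁ k₂ L A e (T + 1) q' O' (runFrom c P) := by
  have key : ∃ (P : Algorithm) (O' : Finset Vertex) (q' : ℕ), LegalFrom s M B k₁ k₂ c P ∧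
      evaluated P = (e T).toList ∧ ioCount P + q = q' ∧
      (runFrom c P).internal = loaded k₁ k₂ L (A T) O' ∧
      (∀ x ∈ O', ∃ t, t < T + 1 ∧ e t = some x) ∧ O'.card < B ∧
      q' * B + O'.card = ((List.range (T + 1)).filterMap e).length ∧
      (∀ t x, t < T + 1 → e t = some x →
        x ∈ O' ∨ ∃ p, p < q' ∧ Item.output x ∈ (runFrom c P).external (2 * p + 1)) ∧
      ∀ a, Even a → (runFrom c P).external a = c.external a := by
    rw [List.range_succ, List.filterMap_append, List.length_append, ← h.count]
    cases hT : e T with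
    | none =>
      refine ⟨[], O, q, trivial, rfl, by simp [ioCount], h.internal, ?_, h.card_lt, by simp [hT],
        ?_, fun _ _ => rfl⟩
      · intro x hx
        obtain ⟨t, ht, hx⟩ := h.buffered x hx
        exact ⟨t, by omega, hx⟩
      · intro t x ht hx
        refine h.saved t x ?_ hx
        rcases Nat.lt_succ_iff_lt_or_eq.1 ht with ht | rfl
        · exact ht
        · simp [hT] at hx
    | some x =>
      have hxO : x ∉ O := fun hx => by
        obtain ⟨t, ht, hx⟩ := h.buffered x hx
        exact absurd (hinj _ _ _ hx hT) (by omega)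
      obtain ⟨P, O', q', h1, h2, h3, h4, h5, h6, h7, h8, h9⟩ :=
        exists_evaluate_output (q := q) h.internal (he T x hT).1 (he T x hT).2 hxO h.card_lt (hM T)
      refine ⟨P, O', q', h1, h2, h3, h4, ?_, h6, by simp [hT]; omega, ?_, ?_⟩
      · intro y hy
        rcases Finset.mem_insert.1 (h5 hy) with rfl | hy
        · exact ⟨T, by omega, hT⟩
        · obtain ⟨t, ht, hx⟩ := h.buffered y hy
          exact ⟨t, by omega, hx⟩
      · intro t y ht hy
        rcases Nat.lt_succ_iff_lt_or_eq.1 ht with ht | rfl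
        · rcases h.saved t y ht hy with hy | ⟨p, hp, hy⟩
          · exact h8 y (Finset.mem_insert_of_mem hy)
          · refine Or.inr ⟨p, by omega, ?_⟩
            rwa [h9 _ (by omega)]
        · obtain rfl : x = y := Option.some_injective _ (hT.symm.trans hy)
          exact h8 x (Finset.mem_insert_self _ _)
      · intro a ha
        refine h9 a ?_
        rintro rfl
        exact absurd ha (by simp)
  obtain ⟨P, O', q', h1, h2, h3, h4, h5, h6, h7, h8, h9⟩ := key
  have hcard : (loaded k₁ k₂ L (A (T + 1)) O').card ≤ M := by
    have := card_loaded_le (k₁ := k₁) (k₂ := k₂) (L := L) (A (T + 1)) O'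
    have := hM (T + 1)
    omega
  obtain ⟨Q, r1, r2, r3, r4, r5, r6⟩ := exists_exchange_blocks (M := M) s hL O' (A T) (A (T + 1))
    (writtenBack A T) (runFrom c P) h4 (writtenBack_subset A T)
    (fun a ha => by
      rw [Finset.mem_sdiff] at ha
      rw [h9 a (hA _ a ha.1)]
      exact h.external a (hA _ a ha.1) ha.2 ⟨T + 1, by omega, ha.1⟩) hcard
  refine ⟨P ++ Q, q', O', legalFrom_append h1 r1, by simp [evaluated_append, h2, r2], ?_, ?_⟩
  · rw [ioCount_append, r3]; omega
  rw [runFrom_append]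
  refine ⟨r4, ?_, ?_, h5, h6, h7⟩
  · intro a ha haT ⟨T', hT', haT'⟩
    by_cases hmem : a ∈ A T
    · exact r5 a (mem_writtenBack.2 ⟨hmem, haT, T', hT', haT'⟩)
    · rw [r6 a (fun h' => hmem (Finset.mem_sdiff.1 (writtenBack_subset A T h')).1)
        (fun h' => haT (Finset.mem_sdiff.1 h').1), h9 a ha]
      exact h.external a ha hmem ⟨T', by omega, haT'⟩
  · intro t x ht hx
    rcases h8 t x ht hx with h' | ⟨p, hp, h'⟩
    · exact Or.inl h'
    · refine Or.inr ⟨p, hp, ?_⟩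
      have hodd : ¬ Even (2 * p + 1) := by simp
      rwa [r6 _ (fun hm => hodd (hA T _ (Finset.mem_sdiff.1 (writtenBack_subset A T hm)).1))
        (fun hm => hodd (hA _ _ (Finset.mem_sdiff.1 hm).1))]

theorem exists_algorithm_of_schedule {A : ℕ → Finset ℕ} {e : ℕ → Option Vertex} (hB : 1 ≤ B)
    (hL : IsDataLayout B k₁ k₂ L) (hA : ∀ T, ∀ a ∈ A T, Even a) (hA0 : A 0 = ∅)
    (hM : ∀ T, ((grid k₁ k₂).filter fun x => L x ∈ A T).card + B ≤ M)
    (he : ∀ T x, e T = some x → x ∈ grid k₁ k₂ ∧ ∀ y ∈ starStencil s k₁ k₂ x, L y ∈ A T)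
    (hinj : ∀ T T' x, e T = some x → e T' = some x → T = T') (n : ℕ) :
    ∃ P : Algorithm, LegalFrom s M B k₁ k₂ (initial k₁ k₂ L) P ∧
      evaluated P = (List.range n).filterMap e ∧
      (∀ T x, T < n → e T = some x →
        ∃ a, Item.output x ∈ (runFrom (initial k₁ k₂ L) P).external a) ∧
      ioCount P ≤ ∑ T ∈ Finset.range n, (A (T + 1) \ A T).card +
        ∑ T ∈ Finset.range n, (writtenBack A T).card +
        (((List.range n).filterMap e).length / B + 1) := by
  have key : ∀ T, ∃ (P : Algorithm) (q : ℕ) (O : Finset Vertex),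
      LegalFrom s M B k₁ k₂ (initial k₁ k₂ L) P ∧
      evaluated P = (List.range T).filterMap e ∧
      ioCount P = ∑ t ∈ Finset.range T, (A (t + 1) \ A t).card +
        ∑ t ∈ Finset.range T, (writtenBack A t).card + q ∧
      ScheduleState B k₁ k₂ L A e T q O (runFrom (initial k₁ k₂ L) P) := by
    intro T
    induction T with
    | zero =>
      refine ⟨[], 0, ∅, trivial, rfl, rfl, ?_⟩
      refine ⟨?_, fun _ _ _ _ => rfl, fun t x ht => absurd ht (by omega), by simp,
        by simpa [Nat.pos_iff_ne_zero, Nat.one_le_iff_ne_zero] using hB, by simp⟩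
      change ∅ = _
      simp [hA0, loaded]
    | succ T ih =>
      obtain ⟨P, q, O, h1, h2, h3, h4⟩ := ih
      obtain ⟨Q, q', O', r1, r2, r3, r4⟩ := exists_step hL hA hM he hinj h4
      refine ⟨P ++ Q, q', O', legalFrom_append h1 r1, ?_, ?_, by rwa [runFrom_append]⟩
      · rw [evaluated_append, h2, r2, List.range_succ, List.filterMap_append]
        congr 1
      · rw [ioCount_append, Finset.sum_range_succ, Finset.sum_range_succ]
        omega
  obtain ⟨P, q, O, h1, h2, h3, h4⟩ := key n
  -- The outputs still buffered go into one last, incomplete block: the `+ 1` in the bound.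
  have hwrite : LegalFrom s M B k₁ k₂ (runFrom (initial k₁ k₂ L) P)
      [.write (2 * q + 1) (O.image Item.output)] := by
    refine ⟨⟨?_, Finset.card_image_le.trans h4.card_lt.le⟩, trivial⟩
    rw [h4.internal]
    exact Finset.subset_union_right
  refine ⟨P ++ [.write (2 * q + 1) (O.image Item.output)], legalFrom_append h1 hwrite, ?_, ?_, ?_⟩
  · rw [evaluated_append, h2]
    simp [evaluated]
  · intro T x hT hx
    rw [runFrom_append]
    change ∃ a, _ ∈ Function.update _ (2 * q + 1) _ a
    rcases h4.saved T x hT hx with h' | ⟨p, hp, h'⟩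
    · refine ⟨2 * q + 1, ?_⟩
      rw [Function.update_self]
      exact Finset.mem_image_of_mem _ h'
    · refine ⟨2 * p + 1, ?_⟩
      rwa [Function.update_of_ne (by omega)]
  · have hq : q ≤ ((List.range n).filterMap e).length / B := by
      rw [Nat.le_div_iff_mul_le (by omega), ← h4.count]
      omega
    rw [ioCount_append, h3]
    have : ioCount [.write (2 * q + 1) (O.image Item.output)] = 1 := rfl
    omega

end Blocks

/-! ### Bands -/

/-- The distance of consecutive working bands. -/
def bandShift (s m : ℕ) : ℤ := 2 * (m : ℤ) - 2 * (s : ℤ)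

/-- The last working band that contains `x`. -/
def bandIndex (s m : ℕ) (x : Vertex) : ℤ := (x.1 - x.2) / bandShift s m

/-- The offset of `x` within the last working band that contains it. -/
def bandOffset (s m : ℕ) (x : Vertex) : ℤ := (x.1 - x.2) % bandShift s m

/-- The working band in which `x` is evaluated. -/
def evalBand (s m : ℕ) (x : Vertex) : ℤ := (x.1 - x.2 - s) / bandShift s m

/-- The position of `x` in working band `j`, ordered by sweep shapes and along the diagonal within
a sweep shape. -/
def sweepIndex (s m : ℕ) (j : ℤ) (x : Vertex) : ℤ :=
  (x.1 + x.2) * m + (x.1 - x.2 - j * bandShift s m) / 2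

section Bands

variable {s m k₁ k₂ : ℕ}

theorem bandShift_pos (h : 2 * s < m) : 0 < bandShift s m := by
  unfold bandShift; omega

theorem bandIndex_spec (h : 2 * s < m) (x : Vertex) :
    x.1 - x.2 = bandIndex s m x * bandShift s m + bandOffset s m x ∧
      0 ≤ bandOffset s m x ∧ bandOffset s m x < bandShift s m := by
  have hW := bandShift_pos h
  exact ⟨by rw [mul_comm]; exact (Int.mul_ediv_add_emod _ _).symm,
    Int.emod_nonneg _ hW.ne', Int.emod_lt_of_pos _ hW⟩

/-- In terms of `x.1 - x.2` a working band has width `2m = bandShift + 2s`, and `2s < bandShift`. So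
no vertex lies in more than two working bands, and it lies in two exactly when its offset is below
`2s`. -/
theorem mem_workingBand_iff_bandIndex (h : 2 * s < m) (j : ℤ) (x : Vertex) :
    x ∈ workingBand s m j ↔
      j = bandIndex s m x ∨ (j = bandIndex s m x - 1 ∧ bandOffset s m x < 2 * s) := by
  obtain ⟨h1, h2, h3⟩ := bandIndex_spec h x
  have hW := bandShift_pos h
  rw [mem_workingBand_iff]
  change j * bandShift s m ≤ _ ∧ _ < j * bandShift s m + _ ↔ _
  rw [h1]
  set q := bandIndex s m x
  set r := bandOffset s m x
  have hWdef : bandShift s m = 2 * (m : ℤ) - 2 * (s : ℤ) := rfl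
  set W := bandShift s m
  rcases lt_trichotomy j (q - 1) with hj | hj | hj
  · have : (j + 2) * W ≤ q * W := mul_le_mul_of_nonneg_right (by omega) hW.le
    rw [add_mul] at this
    omega
  · have : (j + 1) * W = q * W := by rw [hj]; ring
    rw [add_mul] at this
    omega
  · rcases (show q ≤ j by omega).eq_or_lt with hj' | hj'
    · rw [← hj']; omega
    · have : (q + 1) * W ≤ j * W := mul_le_mul_of_nonneg_right (by omega) hW.le
      rw [add_mul] at this
      omega

theorem SameBand.symm {x y : Vertex} (h : SameBand s m x y) : SameBand s m y x :=
  fun j => (h j).symm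

theorem SameBand.trans {x y z : Vertex} (h : SameBand s m x y) (h' : SameBand s m y z) :
    SameBand s m x z :=
  fun j => (h j).trans (h' j)

theorem sameBand_iff (h : 2 * s < m) (x y : Vertex) :
    SameBand s m x y ↔ bandIndex s m x = bandIndex s m y ∧
      (bandOffset s m x < 2 * s ↔ bandOffset s m y < 2 * s) := by
  simp only [SameBand, mem_workingBand_iff_bandIndex h]
  constructor
  · intro H
    have h1 := H (bandIndex s m x)
    have h2 := H (bandIndex s m y)
    have h3 := H (bandIndex s m x - 1)
    omega
  · rintro ⟨h1, h2⟩ j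
    rw [h1, h2]

theorem evalBand_spec (h : 2 * s < m) (x : Vertex) :
    evalBand s m x * bandShift s m + s ≤ x.1 - x.2 ∧
      x.1 - x.2 < evalBand s m x * bandShift s m + bandShift s m + s := by
  have hW := bandShift_pos h
  have h1 := Int.ediv_mul_le (x.1 - x.2 - s) hW.ne'
  have h2 := Int.lt_ediv_add_one_mul_self (x.1 - x.2 - s) hW
  rw [add_mul] at h2
  unfold evalBand
  omega

/-- Trimming `s` from both sides of a working band leaves width `bandShift`, so the trimmed bands
tile the plane; within `ℓ¹` distance `s` the difference `x.1 - x.2` changes by at most `s`. -/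
theorem evaluatedAt_evalBand (h : 2 * s < m) (x : Vertex) :
    EvaluatedAt s m (evalBand s m x) (x.1 + x.2 - evalBand s m x * bandShift s m) x := by
  obtain ⟨h1, h2⟩ := evalBand_spec h x
  have hWdef : bandShift s m = 2 * (m : ℤ) - 2 * (s : ℤ) := rfl
  refine ⟨(mem_sweepShape_iff _ _ _ _ _).2 ?_, fun y hy => (mem_workingBand_iff _ _ _ _).2 ?_⟩
  · rw [← hWdef]
    generalize evalBand s m x * bandShift s m = c at *
    omega
  · rw [← hWdef]
    unfold dist1 at hy
    have h3 := le_abs_self (y.1 - x.1)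
    have h4 := neg_abs_le (y.1 - x.1)
    have h5 := le_abs_self (y.2 - x.2)
    have h6 := neg_abs_le (y.2 - x.2)
    generalize evalBand s m x * bandShift s m = c at *
    omega

/-- Inside the band the second summand of `sweepIndex` lies in `[0, m)`, so the index is a
lexicographic code. -/
theorem sweepIndex_le_iff {j : ℤ} {x y : Vertex} (hx : x ∈ workingBand s m j)
    (hy : y ∈ workingBand s m j) :
    sweepIndex s m j x ≤ sweepIndex s m j y ↔
      x.1 + x.2 < y.1 + y.2 ∨ (x.1 + x.2 = y.1 + y.2 ∧ x.1 ≤ y.1) := by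
  rw [mem_workingBand_iff] at hx hy
  change j * bandShift s m ≤ _ ∧ _ < j * bandShift s m + _ at hx hy
  -- As the shift is even, `x.1 + x.2` determines the parity of the halved difference, so halving
  -- loses no information.
  have heven : j * bandShift s m = 2 * (j * (m - s)) := by unfold bandShift; ring
  unfold sweepIndex
  generalize j * (m - s : ℤ) = d at *
  generalize j * bandShift s m = c at *
  rcases lt_trichotomy (x.1 + x.2) (y.1 + y.2) with h | h | h
  · have : (x.1 + x.2 + 1) * m ≤ (y.1 + y.2) * m :=
      mul_le_mul_of_nonneg_right (by omega) (by omega)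
    rw [add_mul (x.1 + x.2)] at this
    omega
  · rw [h]
    omega
  · have : (y.1 + y.2 + 1) * m ≤ (x.1 + x.2) * m :=
      mul_le_mul_of_nonneg_right (by omega) (by omega)
    rw [add_mul (y.1 + y.2)] at this
    omega

theorem sweepIndex_injOn (s m : ℕ) (j : ℤ) : Set.InjOn (sweepIndex s m j) (workingBand s m j) := by
  intro x hx y hy h
  have h1 := (sweepIndex_le_iff hx hy).1 h.le
  have h2 := (sweepIndex_le_iff hy hx).1 h.ge
  exact Prod.ext (by omega) (by omega)

theorem abs_sweepIndex_sub_le {x y : Vertex} (h : dist1 y x ≤ s) (j : ℤ) :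
    sweepIndex s m j y ≤ sweepIndex s m j x + (s * m + s) ∧
      sweepIndex s m j x ≤ sweepIndex s m j y + (s * m + s) := by
  unfold dist1 at h
  have h3 := le_abs_self (y.1 - x.1)
  have h4 := neg_abs_le (y.1 - x.1)
  have h5 := le_abs_self (y.2 - x.2)
  have h6 := neg_abs_le (y.2 - x.2)
  have h7 : (y.1 + y.2) * (m : ℤ) ≤ (x.1 + x.2 + s) * m :=
    mul_le_mul_of_nonneg_right (by omega) (by omega)
  have h8 : (x.1 + x.2) * (m : ℤ) ≤ (y.1 + y.2 + s) * m :=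
    mul_le_mul_of_nonneg_right (by omega) (by omega)
  rw [add_mul _ (s : ℤ)] at h7 h8
  unfold sweepIndex
  omega

/-! ### Positions within a band -/

theorem mem_grid {x : Vertex} :
    x ∈ grid k₁ k₂ ↔ (1 ≤ x.1 ∧ x.1 ≤ k₁) ∧ 1 ≤ x.2 ∧ x.2 ≤ k₂ := by
  simp [grid, Finset.mem_product]

theorem bandPosition_le {x y : Vertex} (h : SameBand s m x y)
    (hxy : x.1 + x.2 < y.1 + y.2 ∨ (x.1 + x.2 = y.1 + y.2 ∧ x.1 ≤ y.1)) :
    bandPosition s m k₁ k₂ x ≤ bandPosition s m k₁ k₂ y := by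
  classical
  refine Finset.card_le_card fun z hz => ?_
  rw [Finset.mem_filter] at hz ⊢
  exact ⟨hz.1, h.symm.trans hz.2.1, by omega⟩

theorem bandPosition_lt_card {x : Vertex} {S : Finset Vertex} (hx : x ∈ S)
    (hS : ∀ y ∈ grid k₁ k₂, SameBand s m x y → y ∈ S) :
    bandPosition s m k₁ k₂ x < S.card := by
  classical
  refine Finset.card_lt_card ((Finset.ssubset_iff_of_subset fun z hz => ?_).2 ⟨x, hx, ?_⟩)
  · rw [Finset.mem_filter] at hz
    exact hS z hz.1 hz.2.1
  · rw [Finset.mem_filter]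
    omega

theorem bandPosition_lt {x y : Vertex} (hx : x ∈ grid k₁ k₂) (h : SameBand s m x y)
    (hxy : x.1 + x.2 < y.1 + y.2 ∨ (x.1 + x.2 = y.1 + y.2 ∧ x.1 < y.1)) :
    bandPosition s m k₁ k₂ x < bandPosition s m k₁ k₂ y := by
  classical
  refine Finset.card_lt_card ((Finset.ssubset_iff_of_subset fun z hz => ?_).2 ⟨x, ?_, ?_⟩)
  · rw [Finset.mem_filter] at hz ⊢
    exact ⟨hz.1, h.symm.trans hz.2.1, by omega⟩
  · exact Finset.mem_filter.2 ⟨hx, h.symm, hxy⟩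
  · rw [Finset.mem_filter]
    omega

theorem bandPosition_inj {x y : Vertex} (hx : x ∈ grid k₁ k₂) (hy : y ∈ grid k₁ k₂)
    (h : SameBand s m x y) (hxy : bandPosition s m k₁ k₂ x = bandPosition s m k₁ k₂ y) :
    x = y := by
  have h1 := mt (bandPosition_lt hx h) hxy.not_lt
  have h2 := mt (bandPosition_lt hy h.symm) hxy.not_gt
  exact Prod.ext (by omega) (by omega)

/-! ### The layout -/

/-- A block aligned diagonal layout that uses only blocks with even numbers. -/
noncomputable def diagonalLayout (s m B k₁ k₂ : ℕ) (x : Vertex) : ℕ :=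
  2 * Encodable.encode (bandIndex s m x, decide (bandOffset s m x < 2 * s),
    bandPosition s m k₁ k₂ x / B)

variable {B : ℕ}

theorem even_diagonalLayout (x : Vertex) : Even (diagonalLayout s m B k₁ k₂ x) :=
  even_two_mul _

theorem diagonalLayout_eq_iff (h : 2 * s < m) (x y : Vertex) :
    diagonalLayout s m B k₁ k₂ x = diagonalLayout s m B k₁ k₂ y ↔
      SameBand s m x y ∧
        bandPosition s m k₁ k₂ x / B = bandPosition s m k₁ k₂ y / B := by
  rw [sameBand_iff h, diagonalLayout, diagonalLayout, Nat.mul_right_inj two_ne_zero,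
    Encodable.encode_inj, Prod.mk.injEq, Prod.mk.injEq, decide_eq_decide, and_assoc]

/-- Positions in one block have the same quotient by `B`, so their remainders tell the vertices
apart. -/
theorem card_le_of_diagonalLayout_eq (h : 2 * s < m) (hB : 1 ≤ B) {S : Finset Vertex}
    (hS : S ⊆ grid k₁ k₂)
    (hL : ∀ x ∈ S, ∀ y ∈ S, diagonalLayout s m B k₁ k₂ x = diagonalLayout s m B k₁ k₂ y) :
    S.card ≤ B := by
  rcases S.eq_empty_or_nonempty with rfl | ⟨x₀, hx₀⟩
  · simp
  have hmaps : ∀ x ∈ S, bandPosition s m k₁ k₂ x % B ∈ Finset.range B := fun x _ =>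
    Finset.mem_range.2 (Nat.mod_lt _ hB)
  rw [← Finset.card_range B]
  refine Finset.card_le_card_of_injOn _ hmaps fun x hx y hy hxy => ?_
  obtain ⟨h1, h2⟩ := (diagonalLayout_eq_iff h x y).1 (hL x hx y hy)
  refine bandPosition_inj (hS hx) (hS hy) h1 ?_
  have hxy : bandPosition s m k₁ k₂ x % B = bandPosition s m k₁ k₂ y % B := hxy
  rw [← Nat.div_add_mod (bandPosition s m k₁ k₂ x) B, h2, hxy, Nat.div_add_mod]

theorem isDataLayout_diagonalLayout (h : 2 * s < m) (hB : 1 ≤ B) :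
    IsDataLayout B k₁ k₂ (diagonalLayout s m B k₁ k₂) := fun a =>
  card_le_of_diagonalLayout_eq h hB (Finset.filter_subset _ _) fun x hx y hy => by
    rw [(Finset.mem_filter.1 hx).2, (Finset.mem_filter.1 hy).2]

/-- A band is stored in as few blocks as possible, up to rounding. -/
theorem card_image_diagonalLayout_le (h : 2 * s < m) {S : Finset Vertex}
    (hsame : ∀ x ∈ S, ∀ y ∈ S, SameBand s m x y)
    (hclosed : ∀ x ∈ S, ∀ y ∈ grid k₁ k₂, SameBand s m x y → y ∈ S) :
    (S.image (diagonalLayout s m B k₁ k₂)).card ≤ S.card / B + 1 := by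
  rw [← Finset.card_range (S.card / B + 1)]
  rcases S.eq_empty_or_nonempty with rfl | ⟨x₀, hx₀⟩
  · simp
  refine Finset.card_le_card_of_surjOn (fun p => 2 * Encodable.encode (bandIndex s m x₀,
    decide (bandOffset s m x₀ < 2 * s), p)) fun a ha => ?_
  rw [Finset.mem_coe, Finset.mem_image] at ha
  obtain ⟨x, hx, rfl⟩ := ha
  refine ⟨bandPosition s m k₁ k₂ x / B, ?_, ?_⟩
  · rw [Finset.coe_range, Set.mem_Iio, Nat.lt_succ_iff]
    exact Nat.div_le_div_right (bandPosition_lt_card hx (hclosed x hx)).le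
  · obtain ⟨h1, h2⟩ := (sameBand_iff h x₀ x).1 (hsame x₀ hx₀ x hx)
    simp only [diagonalLayout, h1, h2]

/-- The part of a block that lies beyond a cut through a band belongs to a single block. -/
theorem diagonalLayout_eq_of_between (h : 2 * s < m) {j : ℤ} {x y z : Vertex}
    (hx : x ∈ workingBand s m j) (hxy : SameBand s m x y)
    (hzx : sweepIndex s m j z ≤ sweepIndex s m j x) (hxy' : sweepIndex s m j x ≤ sweepIndex s m j y)
    (hz : diagonalLayout s m B k₁ k₂ z = diagonalLayout s m B k₁ k₂ y) :
    diagonalLayout s m B k₁ k₂ x = diagonalLayout s m B k₁ k₂ y := by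
  obtain ⟨h1, h2⟩ := (diagonalLayout_eq_iff h z y).1 hz
  have hy := (hxy j).1 hx
  have hzj := (h1 j).2 hy
  have hzx' := h1.trans hxy.symm
  refine (diagonalLayout_eq_iff h x y).2 ⟨hxy, le_antisymm ?_ ?_⟩
  · exact Nat.div_le_div_right (bandPosition_le hxy ((sweepIndex_le_iff hx hy).1 hxy'))
  · rw [← h2]
    exact Nat.div_le_div_right (bandPosition_le hzx' ((sweepIndex_le_iff hzj hx).1 hzx))

end Bands

/-! ### The schedule of the diagonal sweep -/

open scoped Classical in
/-- The grid vertices of working band `j`. -/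
noncomputable def bandVertices (s m k₁ k₂ : ℕ) (j : ℤ) : Finset Vertex :=
  (grid k₁ k₂).filter fun x => x ∈ workingBand s m j

open scoped Classical in
/-- The blocks of working band `j` that meet both half-bands whose intersection is the window of
sweep indices from `p - 2 (s m + s)` to `p`. -/
noncomputable def activeBlocks (s m B k₁ k₂ : ℕ) (j p : ℤ) : Finset ℕ :=
  ((bandVertices s m k₁ k₂ j).image (diagonalLayout s m B k₁ k₂)).filter fun a =>
    (∃ y ∈ grid k₁ k₂, diagonalLayout s m B k₁ k₂ y = a ∧ sweepIndex s m j y ≤ p) ∧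
    ∃ z ∈ grid k₁ k₂, diagonalLayout s m B k₁ k₂ z = a ∧
      p - 2 * (s * m + s) ≤ sweepIndex s m j z

/-- The number of steps of the schedule for a single working band. -/
def sweepLength (s m k₁ k₂ : ℕ) : ℕ := (k₁ + k₂ + 1) * m + 2 * (s * m + s) + 1

/-- The blocks in internal memory at step `T`, if the sweep starts with working band `j₀`. -/
noncomputable def sweepBlocks (s m B k₁ k₂ : ℕ) (j₀ : ℤ) (T : ℕ) : Finset ℕ :=
  activeBlocks s m B k₁ k₂ (j₀ + (T / sweepLength s m k₁ k₂ : ℕ))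
    (T % sweepLength s m k₁ k₂ : ℕ)

open scoped Classical in
/-- The vertex evaluated at step `T`, if the sweep starts with working band `j₀`. -/
noncomputable def sweepVertex (s m k₁ k₂ : ℕ) (j₀ : ℤ) (T : ℕ) : Option Vertex :=
  if h : ∃ x ∈ grid k₁ k₂, evalBand s m x = j₀ + (T / sweepLength s m k₁ k₂ : ℕ) ∧
      sweepIndex s m (evalBand s m x) x + (s * m + s) = (T % sweepLength s m k₁ k₂ : ℕ) then
    some h.choose else none

section Schedule

variable {s m B k₁ k₂ : ℕ}

theorem mem_bandVertices {j : ℤ} {x : Vertex} :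
    x ∈ bandVertices s m k₁ k₂ j ↔ x ∈ grid k₁ k₂ ∧ x ∈ workingBand s m j := by
  simp [bandVertices]

theorem mem_activeBlocks {j p : ℤ} {a : ℕ} :
    a ∈ activeBlocks s m B k₁ k₂ j p ↔
      (∃ x ∈ bandVertices s m k₁ k₂ j, diagonalLayout s m B k₁ k₂ x = a) ∧
      (∃ y ∈ grid k₁ k₂, diagonalLayout s m B k₁ k₂ y = a ∧ sweepIndex s m j y ≤ p) ∧
      ∃ z ∈ grid k₁ k₂, diagonalLayout s m B k₁ k₂ z = a ∧
        p - 2 * (s * m + s) ≤ sweepIndex s m j z := by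
  simp only [activeBlocks, Finset.mem_filter, Finset.mem_image]

theorem mem_workingBand_of_diagonalLayout_eq (h : 2 * s < m) {j : ℤ} {x y : Vertex}
    (hx : x ∈ workingBand s m j)
    (hxy : diagonalLayout s m B k₁ k₂ y = diagonalLayout s m B k₁ k₂ x) :
    y ∈ workingBand s m j :=
  (((diagonalLayout_eq_iff h y x).1 hxy).1 j).2 hx

/-- One condition is monotone in `p`, the other antitone. This is the reason for asking that a block
meet both half-bands instead of the window itself, which a block could leave and enter again. -/
theorem activeBlocks_convex {j p q r : ℤ} {a : ℕ} (hp : a ∈ activeBlocks s m B k₁ k₂ j p)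
    (hr : a ∈ activeBlocks s m B k₁ k₂ j r) (hpq : p ≤ q) (hqr : q ≤ r) :
    a ∈ activeBlocks s m B k₁ k₂ j q := by
  rw [mem_activeBlocks] at *
  obtain ⟨h1, ⟨y, hy, hya, hyp⟩, -⟩ := hp
  obtain ⟨-, -, ⟨z, hz, hza, hzr⟩⟩ := hr
  exact ⟨h1, ⟨y, hy, hya, by omega⟩, ⟨z, hz, hza, by omega⟩⟩

theorem sweepIndex_bounds (hm : 0 < m) {j : ℤ} {x : Vertex} (hx : x ∈ bandVertices s m k₁ k₂ j) :
    0 < sweepIndex s m j x ∧ sweepIndex s m j x < (k₁ + k₂ + 1 : ℕ) * m := by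
  obtain ⟨hg, hx⟩ := mem_bandVertices.1 hx
  rw [mem_workingBand_iff] at hx
  change j * bandShift s m ≤ _ ∧ _ < j * bandShift s m + _ at hx
  rw [mem_grid] at hg
  have h1 : 2 * (m : ℤ) ≤ (x.1 + x.2) * m := mul_le_mul_of_nonneg_right (by omega) (by omega)
  have h2 : (x.1 + x.2) * (m : ℤ) ≤ (k₁ + k₂) * m :=
    mul_le_mul_of_nonneg_right (by omega) (by omega)
  have h3 : ((k₁ + k₂ + 1 : ℕ) : ℤ) * m = (k₁ + k₂) * m + m := by push_cast; ring
  rw [h3]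
  unfold sweepIndex
  omega

theorem activeBlocks_eq_empty_of_nonpos (h : 2 * s < m) {j p : ℤ} (hp : p ≤ 0) :
    activeBlocks s m B k₁ k₂ j p = ∅ := by
  refine Finset.eq_empty_of_forall_notMem fun a ha => ?_
  obtain ⟨⟨x, hx, hxa⟩, ⟨y, hy, hya, hyp⟩, -⟩ := mem_activeBlocks.1 ha
  have := (sweepIndex_bounds (by omega) (mem_bandVertices.2 ⟨hy,
    mem_workingBand_of_diagonalLayout_eq h (mem_bandVertices.1 hx).2 (hya.trans hxa.symm)⟩)).1
  omega

/-- At the last step of a working band the lower end of the window has passed all its vertices.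
Together with the empty start, this leaves no inputs in memory between working bands. -/
theorem activeBlocks_eq_empty_of_le (h : 2 * s < m) {j p : ℤ}
    (hp : (sweepLength s m k₁ k₂ : ℤ) ≤ p + 1) :
    activeBlocks s m B k₁ k₂ j p = ∅ := by
  refine Finset.eq_empty_of_forall_notMem fun a ha => ?_
  obtain ⟨⟨x, hx, hxa⟩, -, ⟨z, hz, hza, hzp⟩⟩ := mem_activeBlocks.1 ha
  have := (sweepIndex_bounds (by omega) (mem_bandVertices.2 ⟨hz,
    mem_workingBand_of_diagonalLayout_eq h (mem_bandVertices.1 hx).2 (hza.trans hxa.symm)⟩)).2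
  unfold sweepLength at hp
  push_cast at hp this
  omega

/-! ### Internal memory -/

/-- A working band consists of a wing, a core and a wing band, and `S` meets at most one block of
each. -/
theorem card_le_of_subset_bandVertices (h : 2 * s < m) (hB : 1 ≤ B) {j : ℤ} {S : Finset Vertex}
    (hS : S ⊆ bandVertices s m k₁ k₂ j)
    (hL : ∀ x ∈ S, ∀ y ∈ S, SameBand s m x y →
      diagonalLayout s m B k₁ k₂ x = diagonalLayout s m B k₁ k₂ y) :
    S.card ≤ B * 3 := by
  let f : Vertex → ℤ × Bool := fun x => (bandIndex s m x, decide (bandOffset s m x < 2 * s))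
  refine (Finset.card_le_mul_card_image (f := f) S B fun b _ => ?_).trans
    (Nat.mul_le_mul_left _ ?_)
  · refine card_le_of_diagonalLayout_eq (k₁ := k₁) (k₂ := k₂) h hB (fun x hx => ?_) (fun x hx y hy => ?_)
    · exact (mem_bandVertices.1 (hS (Finset.mem_filter.1 hx).1)).1
    · rw [Finset.mem_filter] at hx hy
      refine hL x hx.1 y hy.1 ((sameBand_iff h x y).2 ?_)
      have := hx.2.trans hy.2.symm
      simpa [f] using this
  · refine (Finset.card_le_card (t := {(j, true), (j, false), (j + 1, true)}) ?_).trans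
      Finset.card_le_three
    intro b hb
    obtain ⟨x, hx, rfl⟩ := Finset.mem_image.1 hb
    rcases (mem_workingBand_iff_bandIndex h j x).1 (mem_bandVertices.1 (hS hx)).2 with h1 | ⟨h1, h2⟩
    · by_cases h2 : bandOffset s m x < 2 * s <;> simp [f, h2, ← h1]
    · have : bandIndex s m x = j + 1 := by omega
      simp [f, h2, this]

theorem card_activeBlocks_vertices_le (h : 2 * s < m) (hB : 1 ≤ B) (j p : ℤ) :
    ((grid k₁ k₂).filter fun x =>
      diagonalLayout s m B k₁ k₂ x ∈ activeBlocks s m B k₁ k₂ j p).card ≤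
      2 * (s * m + s) + 1 + B * 6 := by
  set U := (grid k₁ k₂).filter fun x =>
    diagonalLayout s m B k₁ k₂ x ∈ activeBlocks s m B k₁ k₂ j p with hU
  have hUsub : U ⊆ bandVertices s m k₁ k₂ j := fun x hx => by
    obtain ⟨hg, hx⟩ := Finset.mem_filter.1 hx
    obtain ⟨⟨y, hy, hyx⟩, -⟩ := mem_activeBlocks.1 hx
    exact mem_bandVertices.2
      ⟨hg, mem_workingBand_of_diagonalLayout_eq h (mem_bandVertices.1 hy).2 hyx.symm⟩
  have hUband : ∀ x ∈ U, x ∈ workingBand s m j := fun x hx => (mem_bandVertices.1 (hUsub hx)).2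
  have hahead : (U.filter fun x => p < sweepIndex s m j x).card ≤ B * 3 := by
    refine card_le_of_subset_bandVertices h hB ((Finset.filter_subset _ _).trans hUsub) ?_
    have key : ∀ x ∈ U, ∀ y ∈ U, p < sweepIndex s m j x → SameBand s m x y →
        sweepIndex s m j x ≤ sweepIndex s m j y →
        diagonalLayout s m B k₁ k₂ x = diagonalLayout s m B k₁ k₂ y := by
      intro x hx y hy hpx hxy hle
      obtain ⟨-, ⟨z, hz, hzy, hzp⟩, -⟩ := mem_activeBlocks.1 (Finset.mem_filter.1 hy).2
      -- The block of `y` reaches back to `z`, at or before `p`, so it contains the vertex `x` in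
      -- between.
      exact diagonalLayout_eq_of_between h (hUband x hx) hxy (by omega) hle hzy
    intro x hx y hy hxy
    rw [Finset.mem_filter] at hx hy
    rcases le_total (sweepIndex s m j x) (sweepIndex s m j y) with hle | hle
    · exact key x hx.1 y hy.1 hx.2 hxy hle
    · exact (key y hy.1 x hx.1 hy.2 hxy.symm hle).symm
  have hbehind : (U.filter fun x => sweepIndex s m j x < p - 2 * (s * m + s)).card ≤ B * 3 := by
    refine card_le_of_subset_bandVertices h hB ((Finset.filter_subset _ _).trans hUsub) ?_
    have key : ∀ x ∈ U, ∀ y ∈ U, sweepIndex s m j x < p - 2 * (s * m + s) → SameBand s m x y →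
        sweepIndex s m j y ≤ sweepIndex s m j x →
        diagonalLayout s m B k₁ k₂ x = diagonalLayout s m B k₁ k₂ y := by
      intro x hx y hy hpx hxy hle
      obtain ⟨-, -, ⟨z, hz, hzy, hzp⟩⟩ := mem_activeBlocks.1 (Finset.mem_filter.1 hy).2
      have hyz := ((diagonalLayout_eq_iff h z y).1 hzy).1.symm
      rw [← hzy]
      exact diagonalLayout_eq_of_between h (hUband x hx) (hxy.trans hyz) hle (by omega) hzy.symm
    intro x hx y hy hxy
    rw [Finset.mem_filter] at hx hy
    rcases le_total (sweepIndex s m j y) (sweepIndex s m j x) with hle | hle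
    · exact key x hx.1 y hy.1 hx.2 hxy hle
    · exact (key y hy.1 x hx.1 hy.2 hxy.symm hle).symm
  have hmid : (U.filter fun x => p - 2 * (s * m + s) ≤ sweepIndex s m j x ∧
      sweepIndex s m j x ≤ p).card ≤ 2 * (s * m + s) + 1 := by
    have hcard : (Finset.Icc (p - 2 * (s * m + s)) p).card = 2 * (s * m + s) + 1 := by
      rw [Int.card_Icc]
      have : ((2 * (s * m + s) + 1 : ℕ) : ℤ) = 2 * (s * m + s) + 1 := by push_cast; ring
      omega
    rw [← hcard]
    refine Finset.card_le_card_of_injOn (sweepIndex s m j) (fun x hx => ?_) ?_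
    · exact Finset.mem_Icc.2 (Finset.mem_filter.1 hx).2
    · exact (sweepIndex_injOn s m j).mono fun x hx => hUband x (Finset.mem_filter.1 hx).1
  have hcover : U ⊆ (U.filter fun x => p - 2 * (s * m + s) ≤ sweepIndex s m j x ∧
      sweepIndex s m j x ≤ p) ∪ ((U.filter fun x => p < sweepIndex s m j x) ∪
      U.filter fun x => sweepIndex s m j x < p - 2 * (s * m + s)) := by
    intro x hx
    simp only [Finset.mem_union, Finset.mem_filter, hx, true_and]
    omega
  have := (Finset.card_le_card hcover).trans ((Finset.card_union_le _ _).trans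
    (Nat.add_le_add_left (Finset.card_union_le _ _) _))
  omega

/-! ### Properties of the schedule -/

theorem sweepLength_pos : 0 < sweepLength s m k₁ k₂ := Nat.succ_pos _

theorem sweepVertex_eq_some_iff (h : 2 * s < m) {j₀ : ℤ} {T : ℕ} {x : Vertex} :
    sweepVertex s m k₁ k₂ j₀ T = some x ↔ x ∈ grid k₁ k₂ ∧
      evalBand s m x = j₀ + (T / sweepLength s m k₁ k₂ : ℕ) ∧
      sweepIndex s m (evalBand s m x) x + (s * m + s) = (T % sweepLength s m k₁ k₂ : ℕ) := by
  unfold sweepVertex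
  split_ifs with hex
  · obtain ⟨h1, h2, h3⟩ := hex.choose_spec
    rw [Option.some_inj]
    refine ⟨fun hx => hx ▸ ⟨h1, h2, h3⟩, fun ⟨_, hx2, hx3⟩ => ?_⟩
    have e1 := (evaluatedAt_evalBand h hex.choose).1
    have e2 := (evaluatedAt_evalBand h x).1
    rw [h2] at h3 e1
    rw [hx2] at hx3 e2
    exact sweepIndex_injOn s m _ ⟨_, e1⟩ ⟨_, e2⟩ (by omega)
  · exact ⟨fun hx => absurd hx (by simp), fun hx => absurd ⟨x, hx⟩ hex⟩

theorem sweepVertex_inj (h : 2 * s < m) {j₀ : ℤ} (T T' : ℕ) (x : Vertex)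
    (hT : sweepVertex s m k₁ k₂ j₀ T = some x) (hT' : sweepVertex s m k₁ k₂ j₀ T' = some x) :
    T = T' := by
  obtain ⟨-, h1, h2⟩ := (sweepVertex_eq_some_iff h).1 hT
  obtain ⟨-, h3, h4⟩ := (sweepVertex_eq_some_iff h).1 hT'
  rw [← Nat.div_add_mod T (sweepLength s m k₁ k₂), ← Nat.div_add_mod T' (sweepLength s m k₁ k₂)]
  have e1 : T / sweepLength s m k₁ k₂ = T' / sweepLength s m k₁ k₂ := by omega
  have e2 : T % sweepLength s m k₁ k₂ = T' % sweepLength s m k₁ k₂ := by omega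
  rw [e1, e2]

/-- The delay `s * m + s` in `sweepVertex` puts `x` at the middle of the window when it is
evaluated. -/
theorem diagonalLayout_mem_sweepBlocks (h : 2 * s < m) {j₀ : ℤ} {T : ℕ} {x y : Vertex}
    (hT : sweepVertex s m k₁ k₂ j₀ T = some x) (hy : y ∈ starStencil s k₁ k₂ x) :
    diagonalLayout s m B k₁ k₂ y ∈ sweepBlocks s m B k₁ k₂ j₀ T := by
  obtain ⟨-, h1, h2⟩ := (sweepVertex_eq_some_iff h).1 hT
  obtain ⟨hyg, hyx⟩ := Finset.mem_filter.1 hy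
  have hyb := (evaluatedAt_evalBand h x).2 y hyx
  obtain ⟨h3, h4⟩ := abs_sweepIndex_sub_le (m := m) hyx (evalBand s m x)
  unfold sweepBlocks
  rw [← h1, ← h2, mem_activeBlocks]
  exact ⟨⟨y, mem_bandVertices.2 ⟨hyg, hyb⟩, rfl⟩, ⟨y, hyg, rfl, by omega⟩, ⟨y, hyg, rfl, by omega⟩⟩

theorem even_of_mem_sweepBlocks {j₀ : ℤ} {T a : ℕ} (ha : a ∈ sweepBlocks s m B k₁ k₂ j₀ T) :
    Even a := by
  obtain ⟨⟨x, -, rfl⟩, -⟩ := mem_activeBlocks.1 ha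
  exact even_diagonalLayout x

theorem exists_sweepVertex_eq (h : 2 * s < m) {j₀ : ℤ} {J : ℕ}
    (hJ : ∀ x ∈ grid k₁ k₂, j₀ ≤ evalBand s m x ∧ evalBand s m x < j₀ + J) {x : Vertex}
    (hx : x ∈ grid k₁ k₂) :
    ∃ T, T < J * sweepLength s m k₁ k₂ ∧ sweepVertex s m k₁ k₂ j₀ T = some x := by
  obtain ⟨h1, h2⟩ := hJ x hx
  obtain ⟨h3, h4⟩ := sweepIndex_bounds (show 0 < m by omega)
    (mem_bandVertices.2 ⟨hx, ⟨_, (evaluatedAt_evalBand h x).1⟩⟩)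
  have hsm : 0 ≤ (s : ℤ) * m := by positivity
  obtain ⟨i, hi⟩ := Int.eq_ofNat_of_zero_le (show 0 ≤ evalBand s m x - j₀ by omega)
  obtain ⟨p, hp⟩ := Int.eq_ofNat_of_zero_le
    (show 0 ≤ sweepIndex s m (evalBand s m x) x + (s * m + s) by omega)
  have hpK : p < sweepLength s m k₁ k₂ := by
    zify
    rw [← hp]
    unfold sweepLength
    push_cast at h4 ⊢
    omega
  have hdiv : (p + sweepLength s m k₁ k₂ * i) / sweepLength s m k₁ k₂ = i := by
    rw [Nat.add_mul_div_left _ _ sweepLength_pos, Nat.div_eq_of_lt hpK, zero_add]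
  have hmod : (p + sweepLength s m k₁ k₂ * i) % sweepLength s m k₁ k₂ = p := by
    rw [Nat.add_mul_mod_self_left, Nat.mod_eq_of_lt hpK]
  refine ⟨p + sweepLength s m k₁ k₂ * i, ?_, ?_⟩
  · rw [← Nat.div_lt_iff_lt_mul sweepLength_pos, hdiv]
    omega
  · rw [sweepVertex_eq_some_iff h, hdiv, hmod]
    exact ⟨hx, by omega, by omega⟩

theorem mem_filterMap_sweepVertex (h : 2 * s < m) {j₀ : ℤ} {J : ℕ}
    (hJ : ∀ x ∈ grid k₁ k₂, j₀ ≤ evalBand s m x ∧ evalBand s m x < j₀ + J) (x : Vertex) :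
    x ∈ (List.range (J * sweepLength s m k₁ k₂)).filterMap (sweepVertex s m k₁ k₂ j₀) ↔
      x ∈ grid k₁ k₂ := by
  rw [List.mem_filterMap]
  constructor
  · rintro ⟨T, -, hT⟩
    exact ((sweepVertex_eq_some_iff h).1 hT).1
  · intro hx
    obtain ⟨T, hT, hTx⟩ := exists_sweepVertex_eq h hJ hx
    exact ⟨T, List.mem_range.2 hT, hTx⟩

theorem nodup_filterMap_sweepVertex (h : 2 * s < m) (j₀ : ℤ) (n : ℕ) :
    ((List.range n).filterMap (sweepVertex s m k₁ k₂ j₀)).Nodup := by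
  refine List.Nodup.filterMap (fun T T' x hT hT' => ?_) List.nodup_range
  exact sweepVertex_inj h T T' x hT hT'

theorem pairwise_filterMap_sweepVertex (h : 2 * s < m) (j₀ : ℤ) (n : ℕ) :
    ((List.range n).filterMap (sweepVertex s m k₁ k₂ j₀)).Pairwise fun x y => ∃ j t j' t' : ℤ,
      EvaluatedAt s m j t x ∧ EvaluatedAt s m j' t' y ∧ (j < j' ∨ (j = j' ∧ t ≤ t')) := by
  rw [List.pairwise_filterMap]
  refine List.pairwise_lt_range.imp fun {T T'} hTT' x hx y hy => ?_
  obtain ⟨-, h1, h2⟩ := (sweepVertex_eq_some_iff h).1 hx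
  obtain ⟨-, h3, h4⟩ := (sweepVertex_eq_some_iff h).1 hy
  have ex := evaluatedAt_evalBand h x
  have ey := evaluatedAt_evalBand h y
  refine ⟨_, _, _, _, ex, ey, ?_⟩
  rcases (Nat.div_le_div_right (c := sweepLength s m k₁ k₂) hTT'.le).lt_or_eq with hd | hd
  · left; omega
  · right
    have hj : evalBand s m x = evalBand s m y := by omega
    refine ⟨hj, ?_⟩
    have e1 := Nat.div_add_mod T (sweepLength s m k₁ k₂)
    have e2 := Nat.div_add_mod T' (sweepLength s m k₁ k₂)
    rw [hd] at e1
    have hle : sweepIndex s m (evalBand s m y) x ≤ sweepIndex s m (evalBand s m y) y := by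
      rw [hj] at h2
      omega
    rw [hj] at ex ⊢
    have := (sweepIndex_le_iff ⟨_, ex.1⟩ ⟨_, ey.1⟩).1 hle
    omega

theorem length_filterMap_sweepVertex (h : 2 * s < m) {j₀ : ℤ} {J : ℕ}
    (hJ : ∀ x ∈ grid k₁ k₂, j₀ ≤ evalBand s m x ∧ evalBand s m x < j₀ + J) :
    ((List.range (J * sweepLength s m k₁ k₂)).filterMap (sweepVertex s m k₁ k₂ j₀)).length =
      k₁ * k₂ := by
  rw [← List.toFinset_card_of_nodup (nodup_filterMap_sweepVertex h _ _)]
  have : ((List.range (J * sweepLength s m k₁ k₂)).filterMap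
      (sweepVertex s m k₁ k₂ j₀)).toFinset = grid k₁ k₂ := by
    ext x
    rw [List.mem_toFinset, mem_filterMap_sweepVertex h hJ]
  rw [this, grid, Finset.card_product, Int.card_Icc, Int.card_Icc]
  simp

end Schedule

/-! ### Counting transfers -/

/-- The pair `(T, a)` is charged to `(T / K, a)`; by `hF` each target is charged at most once. -/
theorem sum_card_le_sum_card_div {K J : ℕ} (hK : 0 < K) (F G : ℕ → Finset ℕ)
    (hFG : ∀ T < J * K, F T ⊆ G (T / K))
    (hF : ∀ T T' a, a ∈ F T → a ∈ F T' → T / K = T' / K → T = T') :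
    ∑ T ∈ Finset.range (J * K), (F T).card ≤ ∑ i ∈ Finset.range J, (G i).card := by
  rw [← Finset.card_sigma, ← Finset.card_sigma]
  refine Finset.card_le_card_of_injOn (fun p => ⟨p.1 / K, p.2⟩) ?_ ?_
  · rintro ⟨T, a⟩ h
    rw [Finset.mem_coe, Finset.mem_sigma, Finset.mem_range] at h
    rw [Finset.mem_coe, Finset.mem_sigma, Finset.mem_range]
    exact ⟨(Nat.div_lt_iff_lt_mul hK).2 h.1, hFG T h.1 h.2⟩
  · rintro ⟨T, a⟩ h ⟨T', a'⟩ h' heq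
    rw [Finset.mem_coe, Finset.mem_sigma] at h h'
    simp only [Sigma.mk.injEq, heq_eq_eq] at heq
    obtain ⟨hdiv, rfl⟩ := heq
    obtain rfl := hF T T' a h.2 h'.2 hdiv
    rfl

open scoped Classical in
/-- The grid vertices in the overlap of the working bands `j - 1` and `j`. -/
noncomputable def wingVertices (s m k₁ k₂ : ℕ) (j : ℤ) : Finset Vertex :=
  (grid k₁ k₂).filter fun x => bandIndex s m x = j ∧ bandOffset s m x < 2 * s

open scoped Classical in
/-- The grid vertices that lie in working band `j` only. -/
noncomputable def coreVertices (s m k₁ k₂ : ℕ) (j : ℤ) : Finset Vertex :=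
  (grid k₁ k₂).filter fun x => bandIndex s m x = j ∧ ¬ bandOffset s m x < 2 * s

section Counting

variable {s m B k₁ k₂ : ℕ}

theorem mem_wingVertices {j : ℤ} {x : Vertex} :
    x ∈ wingVertices s m k₁ k₂ j ↔
      x ∈ grid k₁ k₂ ∧ bandIndex s m x = j ∧ bandOffset s m x < 2 * s := by
  simp [wingVertices]

theorem mem_coreVertices {j : ℤ} {x : Vertex} :
    x ∈ coreVertices s m k₁ k₂ j ↔
      x ∈ grid k₁ k₂ ∧ bandIndex s m x = j ∧ ¬ bandOffset s m x < 2 * s := by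
  simp [coreVertices]

theorem card_image_wingVertices_le (h : 2 * s < m) (j : ℤ) :
    ((wingVertices s m k₁ k₂ j).image (diagonalLayout s m B k₁ k₂)).card ≤
      (wingVertices s m k₁ k₂ j).card / B + 1 := by
  refine card_image_diagonalLayout_le h (fun x hx y hy => ?_) fun x hx y hy hxy => ?_
  · rw [mem_wingVertices] at hx hy
    rw [sameBand_iff h, hx.2.1, hy.2.1]
    simp [hx.2.2, hy.2.2]
  · rw [mem_wingVertices] at hx ⊢
    rw [sameBand_iff h] at hxy
    exact ⟨hy, hxy.1 ▸ hx.2.1, hxy.2.1 hx.2.2⟩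

theorem card_image_coreVertices_le (h : 2 * s < m) (j : ℤ) :
    ((coreVertices s m k₁ k₂ j).image (diagonalLayout s m B k₁ k₂)).card ≤
      (coreVertices s m k₁ k₂ j).card / B + 1 := by
  refine card_image_diagonalLayout_le h (fun x hx y hy => ?_) fun x hx y hy hxy => ?_
  · rw [mem_coreVertices] at hx hy
    rw [sameBand_iff h, hx.2.1, hy.2.1]
    simp only [hx.2.2, hy.2.2, and_self]
  · rw [mem_coreVertices] at hx ⊢
    rw [sameBand_iff h] at hxy
    exact ⟨hy, hxy.1 ▸ hx.2.1, mt hxy.2.2 hx.2.2⟩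

theorem card_image_bandVertices_le (h : 2 * s < m) (j : ℤ) :
    ((bandVertices s m k₁ k₂ j).image (diagonalLayout s m B k₁ k₂)).card ≤
      ((wingVertices s m k₁ k₂ j).card / B + 1) + ((coreVertices s m k₁ k₂ j).card / B + 1) +
        ((wingVertices s m k₁ k₂ (j + 1)).card / B + 1) := by
  have hsub : bandVertices s m k₁ k₂ j ⊆ (wingVertices s m k₁ k₂ j ∪ coreVertices s m k₁ k₂ j) ∪
      wingVertices s m k₁ k₂ (j + 1) := by
    intro x hx
    obtain ⟨hg, hx⟩ := mem_bandVertices.1 hx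
    rw [mem_workingBand_iff_bandIndex h] at hx
    simp only [Finset.mem_union, mem_wingVertices, mem_coreVertices, hg, true_and]
    omega
  refine (Finset.card_le_card (Finset.image_subset_image hsub)).trans ?_
  rw [Finset.image_union, Finset.image_union]
  refine (Finset.card_union_le _ _).trans (Nat.add_le_add ((Finset.card_union_le _ _).trans
    (Nat.add_le_add ?_ ?_)) ?_)
  · exact card_image_wingVertices_le h j
  · exact card_image_coreVertices_le h j
  · exact card_image_wingVertices_le h (j + 1)

/-- A step at which a block is exchanged is not the last one of its working band. -/
theorem div_succ_of_sweepBlocks_ne (h : 2 * s < m) {j₀ : ℤ} {T : ℕ}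
    (hT : (sweepBlocks s m B k₁ k₂ j₀ T).Nonempty ∨ (sweepBlocks s m B k₁ k₂ j₀ (T + 1)).Nonempty) :
    (T + 1) / sweepLength s m k₁ k₂ = T / sweepLength s m k₁ k₂ ∧
      (T + 1) % sweepLength s m k₁ k₂ = T % sweepLength s m k₁ k₂ + 1 := by
  have hK := sweepLength_pos (s := s) (m := m) (k₁ := k₁) (k₂ := k₂)
  have hT' := Nat.mod_add_div T (sweepLength s m k₁ k₂)
  have hlt := Nat.mod_lt T hK
  refine (Nat.div_mod_unique hK).2 ⟨by omega, ?_⟩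
  by_contra hge
  rcases hT with hT | hT
  · exact hT.ne_empty (activeBlocks_eq_empty_of_le h (by omega))
  · have hmod : (T + 1) / sweepLength s m k₁ k₂ = T / sweepLength s m k₁ k₂ + 1 ∧
        (T + 1) % sweepLength s m k₁ k₂ = 0 :=
      (Nat.div_mod_unique hK).2 ⟨by rw [mul_add]; omega, hK⟩
    exact hT.ne_empty (activeBlocks_eq_empty_of_nonpos h (by omega))

theorem sweepBlocks_convex {j₀ : ℤ} {T₁ T₂ T₃ a : ℕ}
    (h₁ : a ∈ sweepBlocks s m B k₁ k₂ j₀ T₁) (h₃ : a ∈ sweepBlocks s m B k₁ k₂ j₀ T₃)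
    (hle : T₁ ≤ T₂) (hle' : T₂ ≤ T₃)
    (hdiv : T₁ / sweepLength s m k₁ k₂ = T₃ / sweepLength s m k₁ k₂) :
    a ∈ sweepBlocks s m B k₁ k₂ j₀ T₂ := by
  have h12 := Nat.div_le_div_right (c := sweepLength s m k₁ k₂) hle
  have h23 := Nat.div_le_div_right (c := sweepLength s m k₁ k₂) hle'
  have e2 : T₂ / sweepLength s m k₁ k₂ = T₁ / sweepLength s m k₁ k₂ := by omega
  have d1 := Nat.div_add_mod T₁ (sweepLength s m k₁ k₂)
  have d2 := Nat.div_add_mod T₂ (sweepLength s m k₁ k₂)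
  have d3 := Nat.div_add_mod T₃ (sweepLength s m k₁ k₂)
  unfold sweepBlocks at *
  rw [← hdiv] at h₃ d3
  rw [e2] at d2 ⊢
  exact activeBlocks_convex h₁ h₃ (by omega) (by omega)

/-- By convexity a block that has left memory does not return within the same working band. -/
theorem sum_card_read_le (h : 2 * s < m) (j₀ : ℤ) (J : ℕ) :
    ∑ T ∈ Finset.range (J * sweepLength s m k₁ k₂),
      (sweepBlocks s m B k₁ k₂ j₀ (T + 1) \ sweepBlocks s m B k₁ k₂ j₀ T).card ≤
      ∑ i ∈ Finset.range J,
        ((bandVertices s m k₁ k₂ (j₀ + i)).image (diagonalLayout s m B k₁ k₂)).card := by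
  refine sum_card_le_sum_card_div sweepLength_pos _
    (fun i => (bandVertices s m k₁ k₂ (j₀ + i)).image (diagonalLayout s m B k₁ k₂)) ?_ ?_
  · intro T _ a ha
    have ha := (Finset.mem_sdiff.1 ha).1
    have hd := (div_succ_of_sweepBlocks_ne h (Or.inr ⟨a, ha⟩)).1
    unfold sweepBlocks at ha
    rw [hd] at ha
    exact Finset.mem_image.2 (mem_activeBlocks.1 ha).1
  · have key : ∀ T T' a, a ∈ sweepBlocks s m B k₁ k₂ j₀ (T + 1) \ sweepBlocks s m B k₁ k₂ j₀ T →
        a ∈ sweepBlocks s m B k₁ k₂ j₀ (T' + 1) \ sweepBlocks s m B k₁ k₂ j₀ T' →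
        T / sweepLength s m k₁ k₂ = T' / sweepLength s m k₁ k₂ → ¬ T < T' := by
      intro T T' a ha ha' hdiv hlt
      rw [Finset.mem_sdiff] at ha ha'
      have hd := (div_succ_of_sweepBlocks_ne h (Or.inr ⟨a, ha.1⟩)).1
      have hd' := (div_succ_of_sweepBlocks_ne h (Or.inr ⟨a, ha'.1⟩)).1
      exact ha'.2 (sweepBlocks_convex ha.1 ha'.1 (by omega) (by omega) (by omega))
    intro T T' a ha ha' hdiv
    have h1 := key T T' a ha ha' hdiv
    have h2 := key T' T a ha' ha hdiv.symm
    omega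

/-- By convexity a released block is needed again only in a later working band. Its vertices then
lie in two working bands, so it belongs to the wing shared with the next one. -/
theorem sum_card_writtenBack_le (h : 2 * s < m) (j₀ : ℤ) (J : ℕ) :
    ∑ T ∈ Finset.range (J * sweepLength s m k₁ k₂),
      (writtenBack (sweepBlocks s m B k₁ k₂ j₀) T).card ≤
      ∑ i ∈ Finset.range J,
        ((wingVertices s m k₁ k₂ (j₀ + i + 1)).image (diagonalLayout s m B k₁ k₂)).card := by
  refine sum_card_le_sum_card_div sweepLength_pos _
    (fun i => (wingVertices s m k₁ k₂ (j₀ + i + 1)).image (diagonalLayout s m B k₁ k₂)) ?_ ?_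
  · intro T _ a ha
    obtain ⟨haT, haT1, T', hT', haT'⟩ := mem_writtenBack.1 ha
    have hlt : T / sweepLength s m k₁ k₂ < T' / sweepLength s m k₁ k₂ := by
      refine lt_of_le_of_ne (Nat.div_le_div_right (by omega)) fun heq => haT1 ?_
      exact sweepBlocks_convex haT haT' (by omega) (by omega) heq
    obtain ⟨⟨x, hx, hxa⟩, -⟩ := mem_activeBlocks.1 haT
    obtain ⟨⟨y, hy, hya⟩, -⟩ := mem_activeBlocks.1 haT'
    have hxT' := mem_workingBand_of_diagonalLayout_eq h (mem_bandVertices.1 hy).2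
      (hxa.trans hya.symm)
    obtain ⟨hg, hxT⟩ := mem_bandVertices.1 hx
    rw [mem_workingBand_iff_bandIndex h] at hxT hxT'
    refine Finset.mem_image.2 ⟨x, mem_wingVertices.2 ⟨hg, ?_⟩, hxa⟩
    omega
  · have key : ∀ T T' a, a ∈ writtenBack (sweepBlocks s m B k₁ k₂ j₀) T →
        a ∈ writtenBack (sweepBlocks s m B k₁ k₂ j₀) T' →
        T / sweepLength s m k₁ k₂ = T' / sweepLength s m k₁ k₂ → ¬ T < T' := by
      intro T T' a ha ha' hdiv hlt
      rw [mem_writtenBack] at ha ha'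
      exact ha.2.1 (sweepBlocks_convex ha.1 ha'.1 (by omega) (by omega) (by omega))
    intro T T' a ha ha' hdiv
    have h1 := key T T' a ha ha' hdiv
    have h2 := key T' T a ha' ha hdiv.symm
    omega

/-! ### Sizes of bands -/

theorem sum_card_wing_core_le (s m k₁ k₂ : ℕ) (j₀ : ℤ) (J : ℕ) :
    ∑ i ∈ Finset.range J, ((wingVertices s m k₁ k₂ (j₀ + i)).card +
      (coreVertices s m k₁ k₂ (j₀ + i)).card) ≤ k₁ * k₂ := by
  classical
  have hgrid : (grid k₁ k₂).card = k₁ * k₂ := by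
    rw [grid, Finset.card_product, Int.card_Icc, Int.card_Icc]
    simp
  rw [← hgrid]
  have hdis : ∀ i : ℕ, Disjoint (wingVertices s m k₁ k₂ (j₀ + i))
      (coreVertices s m k₁ k₂ (j₀ + i)) := fun i =>
    Finset.disjoint_left.2 fun x hx hx' =>
      (mem_coreVertices.1 hx').2.2 (mem_wingVertices.1 hx).2.2
  simp_rw [← Finset.card_union_of_disjoint (hdis _)]
  have hidx : ∀ (i : ℕ) (x : Vertex), x ∈ wingVertices s m k₁ k₂ (j₀ + i) ∪
      coreVertices s m k₁ k₂ (j₀ + i) → x ∈ grid k₁ k₂ ∧ bandIndex s m x = j₀ + i := by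
    intro i x hx
    rw [Finset.mem_union, mem_wingVertices, mem_coreVertices] at hx
    tauto
  rw [← Finset.card_biUnion]
  · refine Finset.card_le_card fun x hx => ?_
    obtain ⟨i, -, hx⟩ := Finset.mem_biUnion.1 hx
    exact (hidx i x hx).1
  · intro i _ i' _ hii'
    refine Finset.disjoint_left.2 fun x hx hx' => hii' ?_
    have := (hidx i x hx).2
    have := (hidx i' x hx').2
    omega

/-- Multiples of `W` cut `[k]` into at most `k / W + 1` intervals, each containing every one of the
`2 * s` admissible residues at most once. -/
theorem card_row_wing_le {W : ℤ} (hW : 0 < W) (k s : ℕ) (c : ℤ) :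
    (((Finset.Icc (1 : ℤ) k).filter fun a => (a - c) % W < 2 * s).card : ℤ) ≤
      2 * s * (k / W + 1) := by
  have hk : 0 ≤ (k : ℤ) / W := Int.ediv_nonneg (by omega) hW.le
  have hcard : ((Finset.Ico (0 : ℤ) (2 * s) ×ˢ Finset.Icc (0 : ℤ) (k / W)).card : ℤ) =
      2 * s * (k / W + 1) := by
    rw [Finset.card_product, Int.card_Ico, Int.card_Icc]
    push_cast
    rw [Int.toNat_of_nonneg (by omega), Int.toNat_of_nonneg (by omega)]
    ring
  rw [← hcard, Nat.cast_le]
  refine Finset.card_le_card_of_injOn (fun a => ((a - c) % W, a / W)) (fun a ha => ?_)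
    fun a _ a' _ haa' => ?_
  · obtain ⟨hak, ha⟩ := Finset.mem_filter.1 ha
    rw [Finset.mem_Icc] at hak
    exact Finset.mem_product.2 ⟨Finset.mem_Ico.2 ⟨Int.emod_nonneg _ hW.ne', ha⟩,
      Finset.mem_Icc.2 ⟨Int.ediv_nonneg (by omega) hW.le, Int.ediv_le_ediv hW hak.2⟩⟩
  · obtain ⟨h1, h2⟩ := Prod.mk.inj haa'
    have h3 : a % W = a' % W := Int.ModEq.add_right_cancel' (-c) h1
    rw [← Int.mul_ediv_add_emod a W, h2, h3, Int.mul_ediv_add_emod]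

theorem sum_card_wing_le (h : 2 * s < m) (k₁ k₂ : ℕ) (j₀ : ℤ) (J : ℕ) :
    ((∑ i ∈ Finset.range J, (wingVertices s m k₁ k₂ (j₀ + i + 1)).card : ℕ) : ℤ) ≤
      k₂ * (2 * s * (k₁ / bandShift s m + 1)) := by
  classical
  have hW := bandShift_pos h
  set S := (grid k₁ k₂).filter fun x => bandOffset s m x < 2 * s with hS
  have h1 : ∑ i ∈ Finset.range J, (wingVertices s m k₁ k₂ (j₀ + i + 1)).card ≤ S.card := by
    rw [← Finset.card_biUnion]
    · refine Finset.card_le_card fun x hx => ?_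
      obtain ⟨i, -, hx⟩ := Finset.mem_biUnion.1 hx
      rw [mem_wingVertices] at hx
      exact Finset.mem_filter.2 ⟨hx.1, hx.2.2⟩
    · intro i _ i' _ hii'
      refine Finset.disjoint_left.2 fun x hx hx' => hii' ?_
      have := (mem_wingVertices.1 hx).2.1
      have := (mem_wingVertices.1 hx').2.1
      omega
  have h2 : S.card = ∑ b ∈ Finset.Icc (1 : ℤ) k₂, (S.filter fun x => x.2 = b).card := by
    refine Finset.card_eq_sum_card_fiberwise fun x hx => ?_
    have := mem_grid.1 (Finset.mem_filter.1 hx).1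
    exact Finset.mem_coe.2 (Finset.mem_Icc.2 this.2)
  have h3 : ∀ b : ℤ, ((S.filter fun x => x.2 = b).card : ℤ) ≤
      2 * s * (k₁ / bandShift s m + 1) := by
    intro b
    refine le_trans (Nat.cast_le.2 ?_) (card_row_wing_le hW k₁ s b)
    refine Finset.card_le_card_of_injOn Prod.fst (fun x hx => ?_) fun x hx y hy hxy => ?_
    · obtain ⟨hxS, hxb⟩ := Finset.mem_filter.1 hx
      obtain ⟨hg, hoff⟩ := Finset.mem_filter.1 hxS
      exact Finset.mem_filter.2 ⟨Finset.mem_Icc.2 (mem_grid.1 hg).1, hxb ▸ hoff⟩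
    · exact Prod.ext hxy ((Finset.mem_filter.1 hx).2.trans (Finset.mem_filter.1 hy).2.symm)
  calc _ ≤ (S.card : ℤ) := by exact_mod_cast h1
    _ = ∑ b ∈ Finset.Icc (1 : ℤ) k₂, ((S.filter fun x => x.2 = b).card : ℤ) := by
        rw [h2]; push_cast; rfl
    _ ≤ ∑ b ∈ Finset.Icc (1 : ℤ) k₂, (2 * s * (k₁ / bandShift s m + 1) : ℤ) :=
        Finset.sum_le_sum fun b _ => h3 b
    _ = k₂ * (2 * s * (k₁ / bandShift s m + 1)) := by simp

end Counting

/-! ### The diagonal sweep algorithm -/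

/-- The diagonal sweep with working bands of `m` vertices per sweep shape. -/
theorem exists_diagonalSweep {s m M B : ℕ} (h : 2 * s < m) (hB : 1 ≤ B)
    (hM : 2 * s * m + 2 * s + 1 + 7 * B ≤ M) (k₁ k₂ : ℕ) :
    ∃ (L : Vertex → ℕ) (P : Algorithm),
      IsBlockAlignedDiagonal s m B k₁ k₂ L ∧ IsDiagonalSweep s m k₁ k₂ P ∧
      EvaluatesStencil s M B k₁ k₂ L P ∧
      (ioCount P : ℝ) ≤
        (2 * (k₁ * k₂) + 2 * (k₂ * (2 * s * (k₁ / (2 * m - 2 * s) + 1)))) / B +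
          4 * (k₁ / (2 * m - 2 * s) + k₂ / (2 * m - 2 * s) + 4) + 1 := by
  have hW := bandShift_pos h
  have hWs : (s : ℤ) ≤ bandShift s m := by unfold bandShift; omega
  -- Every grid vertex has `x.1 - x.2 - s > -k₂ - bandShift`, so none is evaluated before band `j₀`.
  set j₀ : ℤ := -(k₂ / bandShift s m) - 2 with hj₀
  have hk₁ : 0 ≤ (k₁ : ℤ) / bandShift s m := Int.ediv_nonneg (by omega) hW.le
  have hk₂ : 0 ≤ (k₂ : ℤ) / bandShift s m := Int.ediv_nonneg (by omega) hW.le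
  obtain ⟨J, hJdef⟩ := Int.eq_ofNat_of_zero_le
    (show 0 ≤ (k₁ : ℤ) / bandShift s m + k₂ / bandShift s m + 4 by omega)
  have hJ : ∀ x ∈ grid k₁ k₂, j₀ ≤ evalBand s m x ∧ evalBand s m x < j₀ + J := by
    intro x hx
    rw [mem_grid] at hx
    constructor
    · refine (Int.le_ediv_iff_mul_le hW).2 ?_
      have h1 := Int.lt_ediv_add_one_mul_self (k₂ : ℤ) hW
      have h2 : j₀ * bandShift s m =
          -((k₂ / bandShift s m + 1) * bandShift s m) - bandShift s m := by rw [hj₀]; ring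
      omega
    · have : evalBand s m x ≤ k₁ / bandShift s m := Int.ediv_le_ediv hW (by omega)
      omega
  set n := J * sweepLength s m k₁ k₂
  obtain ⟨P, hlegal, heval, hout, hio⟩ := exists_algorithm_of_schedule (s := s) (M := M)
    (A := sweepBlocks s m B k₁ k₂ j₀) (e := sweepVertex s m k₁ k₂ j₀) hB
    (isDataLayout_diagonalLayout h hB) (fun T a ha => even_of_mem_sweepBlocks ha)
    (activeBlocks_eq_empty_of_nonpos h (by simp))
    (fun T => by
      have := card_activeBlocks_vertices_le (k₁ := k₁) (k₂ := k₂) h hB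
        (j₀ + (T / sweepLength s m k₁ k₂ : ℕ)) (T % sweepLength s m k₁ k₂ : ℕ)
      change (Finset.card (Finset.filter (fun x => diagonalLayout s m B k₁ k₂ x ∈
        activeBlocks s m B k₁ k₂ _ _) _)) + B ≤ M
      have h2 : 2 * (s * m + s) = 2 * s * m + 2 * s := by ring
      omega)
    (fun T x hx => ⟨((sweepVertex_eq_some_iff h).1 hx).1,
      fun y hy => diagonalLayout_mem_sweepBlocks h hx hy⟩)
    (sweepVertex_inj h) n
  refine ⟨diagonalLayout s m B k₁ k₂, P, fun x _ y _ => diagonalLayout_eq_iff h x y,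
    ⟨?_, ?_, ?_⟩, ⟨isDataLayout_diagonalLayout h hB, hlegal, ?_⟩, ?_⟩
  · rw [heval]
    exact nodup_filterMap_sweepVertex h _ _
  · rw [heval]
    exact mem_filterMap_sweepVertex h hJ
  · rw [heval]
    exact pairwise_filterMap_sweepVertex h _ _
  · intro x hx
    obtain ⟨T, hT, hTx⟩ := exists_sweepVertex_eq h hJ hx
    exact hout T x hT hTx
  · rw [length_filterMap_sweepVertex h hJ] at hio
    have hread := (sum_card_read_le (B := B) (k₁ := k₁) (k₂ := k₂) h j₀ J).trans
      (Finset.sum_le_sum fun i _ => card_image_bandVertices_le h (j₀ + i))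
    have hwrite := (sum_card_writtenBack_le (B := B) (k₁ := k₁) (k₂ := k₂) h j₀ J).trans
      (Finset.sum_le_sum fun i _ => card_image_wingVertices_le h (j₀ + i + 1))
    have hall : (∑ i ∈ Finset.range J, ((wingVertices s m k₁ k₂ (j₀ + i)).card +
        (coreVertices s m k₁ k₂ (j₀ + i)).card) : ℝ) ≤ k₁ * k₂ := by
      exact_mod_cast sum_card_wing_core_le s m k₁ k₂ j₀ J
    have hWr : ((bandShift s m : ℤ) : ℝ) = 2 * m - 2 * s := by unfold bandShift; push_cast; ring
    have hfloor : ∀ k : ℕ, (((k : ℤ) / bandShift s m : ℤ) : ℝ) ≤ k / (2 * m - 2 * s) := by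
      intro k
      have h1 : (0 : ℝ) < bandShift s m := by exact_mod_cast hW
      rw [← hWr, le_div_iff₀ h1]
      exact_mod_cast Int.ediv_mul_le (k : ℤ) hW.ne'
    have hwing : (∑ i ∈ Finset.range J, (wingVertices s m k₁ k₂ (j₀ + i + 1)).card : ℝ) ≤
        k₂ * (2 * s * (k₁ / (2 * m - 2 * s) + 1)) := by
      have h1 : ((∑ i ∈ Finset.range J, (wingVertices s m k₁ k₂ (j₀ + i + 1)).card : ℕ) : ℝ) ≤
          ((k₂ * (2 * s * (k₁ / bandShift s m + 1)) : ℤ) : ℝ) := by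
        exact_mod_cast sum_card_wing_le h k₁ k₂ j₀ J
      push_cast at h1
      refine h1.trans ?_
      have := hfloor k₁
      gcongr
    have hJr : (J : ℝ) ≤ k₁ / (2 * m - 2 * s) + k₂ / (2 * m - 2 * s) + 4 := by
      have h1 : (((k₁ : ℤ) / bandShift s m + k₂ / bandShift s m + 4 : ℤ) : ℝ) = J := by
        exact_mod_cast hJdef
      have h2 := hfloor k₁
      have h3 := hfloor k₂
      rw [Int.cast_add, Int.cast_add] at h1
      push_cast at h1 h2 h3
      linarith
    have hdiv : ∀ a : ℕ, ((a / B : ℕ) : ℝ) ≤ a / B := fun a => Nat.cast_div_le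
    -- The first wing and the core of each working band are counted by `hall`; the second wing is
    -- the repeated reading. Each of the three is rounded up once.
    have hreadr : (∑ T ∈ Finset.range n, (sweepBlocks s m B k₁ k₂ j₀ (T + 1) \
        sweepBlocks s m B k₁ k₂ j₀ T).card : ℝ) ≤
        (∑ i ∈ Finset.range J, ((wingVertices s m k₁ k₂ (j₀ + i)).card +
        (coreVertices s m k₁ k₂ (j₀ + i)).card) : ℝ) / B +
        (∑ i ∈ Finset.range J, (wingVertices s m k₁ k₂ (j₀ + i + 1)).card : ℝ) / B + 3 * J := by
      refine (Nat.cast_le (α := ℝ).2 hread |> fun h1 => le_trans (by push_cast; rfl) h1).trans ?_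
      rw [Finset.sum_div, Finset.sum_div, ← Finset.sum_add_distrib]
      have h3 : (3 * J : ℝ) = ∑ i ∈ Finset.range J, (3 : ℝ) := by simp [mul_comm]
      rw [h3, ← Finset.sum_add_distrib, Nat.cast_sum]
      refine Finset.sum_le_sum fun i _ => ?_
      have h4 := hdiv (wingVertices s m k₁ k₂ (j₀ + i)).card
      have h5 := hdiv (coreVertices s m k₁ k₂ (j₀ + i)).card
      have h6 := hdiv (wingVertices s m k₁ k₂ (j₀ + i + 1)).card
      rw [add_div]
      simp only [Nat.cast_add, Nat.cast_one]
      linarith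
    have hwriter : (∑ T ∈ Finset.range n,
        (writtenBack (sweepBlocks s m B k₁ k₂ j₀) T).card : ℝ) ≤
        (∑ i ∈ Finset.range J, (wingVertices s m k₁ k₂ (j₀ + i + 1)).card : ℝ) / B + J := by
      refine (Nat.cast_le (α := ℝ).2 hwrite |> fun h1 => le_trans (by push_cast; rfl) h1).trans ?_
      have h3 : (J : ℝ) = ∑ i ∈ Finset.range J, (1 : ℝ) := by simp
      rw [Finset.sum_div, h3, ← Finset.sum_add_distrib, Nat.cast_sum]
      refine Finset.sum_le_sum fun i _ => ?_
      have h6 := hdiv (wingVertices s m k₁ k₂ (j₀ + i + 1)).card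
      simp only [Nat.cast_add, Nat.cast_one]
      linarith
    have hior : (ioCount P : ℝ) ≤ (∑ T ∈ Finset.range n, (sweepBlocks s m B k₁ k₂ j₀ (T + 1) \
        sweepBlocks s m B k₁ k₂ j₀ T).card : ℝ) + (∑ T ∈ Finset.range n,
        (writtenBack (sweepBlocks s m B k₁ k₂ j₀) T).card : ℝ) + (((k₁ * k₂ / B : ℕ) : ℝ) + 1) := by
      exact_mod_cast hio
    have hkk := hdiv (k₁ * k₂)
    rw [Nat.cast_mul] at hkk
    have hB0 : (0 : ℝ) ≤ B := Nat.cast_nonneg _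
    have hallB := div_le_div_of_nonneg_right hall hB0
    have hwingB := div_le_div_of_nonneg_right hwing hB0
    have hsplit : (2 * (k₁ * k₂) + 2 * (k₂ * (2 * s * (k₁ / (2 * m - 2 * s) + 1)))) / (B : ℝ) =
        2 * ((k₁ * k₂ : ℝ) / B) +
          2 * ((k₂ * (2 * s * (k₁ / (2 * m - 2 * s) + 1)) : ℝ) / B) := by ring
    rw [hsplit]
    linarith

/-! ### The leading terms -/

/-- Here `w` stands for `m - s` and `c * B` for the memory not used by the window proper. -/
theorem sweep_cost_le {s M B k₁ k₂ w c : ℝ} (hs : 1 ≤ s) (hB : 0 < B) (hc : 0 ≤ c) (hM : 0 < M)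
    (hcM : 2 * (c * B) ≤ M) (hw : M - c * B ≤ 2 * s * w) (hk₂ : M ≤ k₂) (hk : k₂ ≤ k₁) :
    (2 * (k₁ * k₂) + 2 * (k₂ * (2 * s * (k₁ / (2 * w) + 1)))) / B +
        4 * (k₁ / (2 * w) + k₂ / (2 * w) + 4) + 1 ≤
      (2 + 4 * s ^ 2 / M + (8 * s ^ 2 * c + 16 * s + 17) * (B / M ^ 2 + 1 / k₁)) *
        (k₁ * k₂ / B) := by
  have hk₂0 : 0 < k₂ := hM.trans_le hk₂
  have hk₁0 : 0 < k₁ := hk₂0.trans_le hk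
  have hcB : 0 ≤ c * B := by positivity
  have hsw : M / 2 ≤ 2 * s * w := by linarith
  have hw0 : 0 < w := by
    by_contra hneg
    have : 2 * s * w ≤ 0 := mul_nonpos_of_nonneg_of_nonpos (by linarith) (not_lt.1 hneg)
    linarith
  have hinv : 1 / (2 * s * w) ≤ 1 / M + 2 * (c * B) / M ^ 2 := by
    have h1 : 1 / M + 2 * (c * B) / M ^ 2 = (M + 2 * (c * B)) / M ^ 2 := by field_simp
    rw [h1, div_le_div_iff₀ (by positivity) (by positivity)]
    -- The left side is `M² + cB(M - 2cB)`, which is at least `M²` by `hcM`.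
    have h2 : (M + 2 * (c * B)) * (M - c * B) ≤ (M + 2 * (c * B)) * (2 * s * w) :=
      mul_le_mul_of_nonneg_left hw (by positivity)
    nlinarith [mul_nonneg hcB (sub_nonneg.2 hcM)]
  have hlead : 2 * s / w ≤ 4 * s ^ 2 / M + 8 * s ^ 2 * c * (B / M ^ 2) := by
    calc 2 * s / w = 4 * s ^ 2 * (1 / (2 * s * w)) := by field_simp; ring
      _ ≤ 4 * s ^ 2 * (1 / M + 2 * (c * B) / M ^ 2) := by gcongr
      _ = _ := by ring
  have hw1 : 1 / w ≤ 4 * s / M := by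
    rw [div_le_div_iff₀ hw0 hM]
    linarith
  have hpart : 4 * (k₁ / (2 * w) + k₂ / (2 * w) + 4) + 1 ≤ (16 * s + 17) * (k₁ * k₂ / M ^ 2) := by
    have h1 : k₁ / M ≤ k₁ * k₂ / M ^ 2 := by
      rw [div_le_div_iff₀ hM (by positivity)]
      have : k₁ * M * M ≤ k₁ * M * k₂ := mul_le_mul_of_nonneg_left hk₂ (by positivity)
      nlinarith
    have h2 : 1 ≤ k₁ / M := by rw [le_div_iff₀ hM]; linarith
    have h3 : k₁ * (1 / w) ≤ k₁ * (4 * s / M) := mul_le_mul_of_nonneg_left hw1 hk₁0.le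
    have h4 : k₂ * (1 / w) ≤ k₁ * (1 / w) := mul_le_mul_of_nonneg_right hk (by positivity)
    calc 4 * (k₁ / (2 * w) + k₂ / (2 * w) + 4) + 1
        = 2 * (k₁ * (1 / w)) + 2 * (k₂ * (1 / w)) + 17 := by ring
      _ ≤ 4 * (k₁ * (4 * s / M)) + 17 * (k₁ / M) := by linarith
      _ = (16 * s + 17) * (k₁ / M) := by ring
      _ ≤ _ := by gcongr
  have hX : 0 ≤ k₁ * k₂ / B := by positivity
  have hmain : 2 * s / w * (k₁ * k₂ / B) ≤
      (4 * s ^ 2 / M + 8 * s ^ 2 * c * (B / M ^ 2)) * (k₁ * k₂ / B) :=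
    mul_le_mul_of_nonneg_right hlead hX
  -- The one incomplete period per row amounts to `4*s*k₂/B`.
  have hrow : 4 * s * (1 / k₁) * (k₁ * k₂ / B) ≤
      (8 * s ^ 2 * c + 16 * s + 17) * (1 / k₁) * (k₁ * k₂ / B) := by
    have : 0 ≤ 8 * s ^ 2 * c := by positivity
    gcongr
    linarith
  calc _ = 2 * (k₁ * k₂ / B) + 2 * s / w * (k₁ * k₂ / B) + 4 * s * (1 / k₁) * (k₁ * k₂ / B) +
        (4 * (k₁ / (2 * w) + k₂ / (2 * w) + 4) + 1) := by field_simp; ring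
    _ ≤ 2 * (k₁ * k₂ / B) + (4 * s ^ 2 / M + 8 * s ^ 2 * c * (B / M ^ 2)) * (k₁ * k₂ / B) +
        (8 * s ^ 2 * c + 16 * s + 17) * (1 / k₁) * (k₁ * k₂ / B) +
        (16 * s + 17) * (k₁ * k₂ / M ^ 2) := by linarith
    _ = _ := by field_simp; ring

theorem lowerBoundConstant_two (s : ℕ) : lowerBoundConstant 2 s = 4 * (s : ℝ) ^ 2 := by
  norm_num [lowerBoundConstant, Nat.factorial]

end StencilIO

/-! ### Choice of the constants and of the band width. -/

theorem mainTheorem2 (s : ℕ) (hs : 1 ≤ s) :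
    (∃ C : ℝ, ∃ N : ℕ, ∀ M B k₁ k₂ : ℕ, 1 ≤ B → N * B ≤ M → 5 * M + 1 ≤ k₂ → k₂ ≤ k₁ →
      ∃ (m : ℕ) (L : StencilIO.Vertex → ℕ) (P : StencilIO.Algorithm),
        2 * s < m ∧ 2 * s * m ≤ M ∧ (M : ℝ) ≤ 2 * (s : ℝ) * (m : ℝ) + C * (B : ℝ) ∧
        StencilIO.IsBlockAlignedDiagonal s m B k₁ k₂ L ∧
        StencilIO.IsDiagonalSweep s m k₁ k₂ P ∧
        StencilIO.EvaluatesStencil s M B k₁ k₂ L P ∧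
        (StencilIO.ioCount P : ℝ) ≤
          (2 + 4 * (s : ℝ) ^ 2 / (M : ℝ) + C * ((B : ℝ) / (M : ℝ) ^ 2 + 1 / (k₁ : ℝ))) *
            ((k₁ : ℝ) * (k₂ : ℝ) / (B : ℝ))) ∧
    StencilIO.lowerBoundConstant 2 s = 4 * (s : ℝ) ^ 2 := by
  refine ⟨?_, StencilIO.lowerBoundConstant_two s⟩
  -- In `c`, the part `2s²` pays for `m - s` in place of `m`, and `4s + 8` for the memory reserve
  -- and the rounding of `m`. Taking `N = 2c` yields both `2cB ≤ M` and `2s < m`.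
  obtain ⟨c, hc⟩ : ∃ c : ℕ, c = 2 * s ^ 2 + 4 * s + 8 := ⟨_, rfl⟩
  refine ⟨8 * s ^ 2 * c + 16 * s + 17, 2 * c, fun M B k₁ k₂ hB hM hk₂ hk => ?_⟩
  have hss : s ≤ s * B := Nat.le_mul_of_pos_right s hB
  have hss2 : s ^ 2 ≤ s ^ 2 * B := Nat.le_mul_of_pos_right _ hB
  have hcB : c * B = 2 * (s ^ 2 * B) + 4 * (s * B) + 8 * B := by rw [hc]; ring
  rw [mul_assoc] at hM
  -- The reserve `2sB + 8B` covers the `2s + 1 + 7B` variables needed beyond `2sm`; rounding down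
  -- loses less than `2s ≤ 2sB`.
  set m := (M - (2 * (s * B) + 8 * B)) / (2 * s) with hm
  have h1 := Nat.div_mul_le_self (M - (2 * (s * B) + 8 * B)) (2 * s)
  have h2 := Nat.lt_div_mul_add (a := M - (2 * (s * B) + 8 * B)) (show 0 < 2 * s by omega)
  rw [← hm, mul_comm m] at h1 h2
  have hlow : 2 * s * m + 2 * s + 1 + 7 * B ≤ M := by omega
  have hup : M ≤ 2 * s * m + 4 * (s * B) + 8 * B := by omega
  have hms : 2 * s < m := by
    have : 2 * s * (2 * s) < 2 * s * m := by
      have : 2 * s * (2 * s) = 4 * s ^ 2 := by ring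
      omega
    exact Nat.lt_of_mul_lt_mul_left this
  obtain ⟨L, P, hL, hsweep, heval, hio⟩ := StencilIO.exists_diagonalSweep hms hB hlow k₁ k₂
  have hsr : (1 : ℝ) ≤ s := by exact_mod_cast hs
  have hBr : (1 : ℝ) ≤ B := by exact_mod_cast hB
  have hupr : (M : ℝ) ≤ 2 * s * m + 4 * (s * B) + 8 * B := by exact_mod_cast hup
  have hcr : (c : ℝ) = 2 * s ^ 2 + 4 * s + 8 := by exact_mod_cast hc
  refine ⟨m, L, P, hms, by omega, ?_, hL, hsweep, heval, hio.trans ?_⟩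
  · refine hupr.trans ?_
    have h3 : 0 ≤ (8 * s ^ 2 * c + 12 * s + 9 : ℝ) * B := by positivity
    linarith
  · rw [← mul_sub]
    refine StencilIO.sweep_cost_le hsr (by linarith) (Nat.cast_nonneg c)
      (by exact_mod_cast (show 0 < M by omega)) (by exact_mod_cast hM) ?_
      (by exact_mod_cast (show M ≤ k₂ by omega)) (by exact_mod_cast hk)
    have h3 : (s : ℝ) ^ 2 * 1 ≤ s ^ 2 * B := mul_le_mul_of_nonneg_left hBr (by positivity)
    rw [hcr]
    linarith
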